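/- **Setting.** Fix integers $q\ge 2$, $p\ge 1$, $c\ge 0$ and put $m=c\,p$. Vectors $x\in\mathbb R^m$ are viewed as $c$ channels $x^{(i)}\in\mathbb R^{p}$ with pixels indexed by $\mathbb Z/p$. A convolutional ResNet with $q$ residual blocks is $g_\theta=g^q_{\theta_q}\circ\cdots\circ g^1_{\theta_1}:\mathbb R^m\to\mathbb R^m$ with $$g^k_{\theta_k}(x)=x+U^k\sigma(V^kx),\qquad \sigma(t)=\max(t,0)\ \text{entrywise},$$ where block $k$ has $c_1^k$ hidden channels, $U^k\in\mathbb R^{cp\times c_1^kp}$ and $V^k\in\mathbb R^{c_1^kp\times cp}$ consist of $p\times p$ circulant blocks, namely the circular convolutions with filters $u^k_{i,j}\in\mathbb R^{n_u^k}$ and $v^k_{j,i}\in\mathbb R^{n_v^k}$ ($i\le c$, $j\le c_1^k$) extended by zeros to $\mathbb R^p$, with $1\le n_u^k\le p$. The parameter $\theta\in\mathbb R^D$ collects all entries of all the filters, and $(V^{k'},U^{k})$ is identified with the corresponding filters. Assume $n_v^k=p$ for all $k$. Fix $1\le l\le q-1$. Let $\Theta\subseteq\mathbb R^D$ be the set of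 all $\theta$ such that every $g^k_{\theta_k}$ is an open map, all rows of every $V^k$ are nonzero, and the rows of $V^{l+1}$ are pairwise non-colinear. A function $H:\Theta\to\mathbb R$ is a *conservation law of $g$ with respect to the Euclidean loss* if for every open $\Omega\subseteq\Theta$, every finite nonempty data set $(x_i,y_i)_{i\le N}$ in $\mathbb R^m\times\mathbb R^m$ such that each $\theta\mapsto g_\theta(x_i)$ is $\mathcal C^2$ on $\Omega$, and every solution $\theta:[0,T]\to\Omega$ of $\dot\theta(t)=-\nabla L(\theta(t))$ with $L(\theta)=\frac1N\sum_i\|g_\theta(x_i)-y_i\|_2^2$, one has $H(\theta(T))=H(\theta(0))$. **Theorem.** Let $h$ be a real-valued function of $(V^{l+1},U^l)$ such that $\theta\mapsto h(V^{l+1},U^l)$ is a conservation law of $g$ with respect to the Euclidean loss. Let $\Pi=\{(V^{l+1},U^l):\theta\in\Theta\}$. Then $h$ is constant on each connected component of $\Pi$. If moreover $m\ge 3$, then $\theta\mapsto h(V^{l+1},U^l)$ is constant on the whole of $\Theta$. -/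

import Mathlib

/-- Sizes of a convolutional ResNet with `q` residual blocks acting on `c` channels of `p` pixels:
block `k` has `width k` hidden channels, first-layer filters `v` of length `nv k` and second-layer
filters `u` of length `nu k`. -/
structure ConvArch (q p : ℕ) where
  c : ℕ
  width : Fin q → ℕ
  nu : Fin q → ℕ
  nv : Fin q → ℕ

namespace ConvArch

variable {q p : ℕ}

/-- Indices of the entries of the filters `u_{i,j}` (`Sum.inl (i, j, s)`) and
`v_{j,i}` (`Sum.inr (j, i, s)`) of block `k`, where `i` is an input/output channel and `j` is a
hidden channel. -/
abbrev ParamIdx (A : ConvArch q p) : Type :=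
  Σ k : Fin q, (Fin A.c × Fin (A.width k) × Fin (A.nu k)) ⊕
    (Fin (A.width k) × Fin A.c × Fin (A.nv k))

/-- The parameter space `ℝ^D`: all entries of all filters, with the Euclidean structure. -/
abbrev Param (A : ConvArch q p) : Type := EuclideanSpace ℝ A.ParamIdx

/-- The feature space `ℝ^m`, `m = c * p`. -/
abbrev Feat (A : ConvArch q p) : Type := Fin A.c × ZMod p → ℝ

/-- Extension of a filter of length `n` by zeros to a signal on the `p` cyclically ordered
pixels. -/
def pad (p : ℕ) {n : ℕ} (f : Fin n → ℝ) : ZMod p → ℝ :=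
  fun a => if h : a.val < n then f ⟨a.val, h⟩ else 0

/-- The matrix `U^k` whose circulant blocks are the circular convolutions with `u^k_{i,j}`. -/
def matU (A : ConvArch q p) (θ : A.Param) (k : Fin q) :
    Matrix (Fin A.c × ZMod p) (Fin (A.width k) × ZMod p) ℝ :=
  Matrix.of fun r s =>
    Matrix.circulant (pad p fun t => θ ⟨k, Sum.inl (r.1, s.1, t)⟩) r.2 s.2

/-- The matrix `V^k` whose circulant blocks are the circular convolutions with `v^k_{j,i}`. -/
def matV (A : ConvArch q p) (θ : A.Param) (k : Fin q) :
    Matrix (Fin (A.width k) × ZMod p) (Fin A.c × ZMod p) ℝ :=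
  Matrix.of fun r s =>
    Matrix.circulant (pad p fun t => θ ⟨k, Sum.inr (r.1, s.1, t)⟩) r.2 s.2

/-- The residual block `x ↦ x + U^k σ(V^k x)` with `σ` the entrywise ReLU. -/
noncomputable def block [NeZero p] (A : ConvArch q p) (θ : A.Param) (k : Fin q) (x : A.Feat) :
    A.Feat :=
  x + (A.matU θ k).mulVec (fun r => max ((A.matV θ k).mulVec x r) 0)

/-- The whole network: the blocks are applied in the order `0, 1, …, q - 1`. -/
noncomputable def net [NeZero p] (A : ConvArch q p) (θ : A.Param) (x : A.Feat) : A.Feat :=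
  Fin.foldl q (fun z k => A.block θ k z) x

/-- The admissible parameters: every block is an open map, all rows of every `V^k` are nonzero,
and the rows of `V^{k₀}` are pairwise non-colinear. -/
def admissible [NeZero p] (A : ConvArch q p) (k₀ : Fin q) : Set A.Param :=
  {θ | (∀ k, IsOpenMap (A.block θ k)) ∧ (∀ k r, (A.matV θ k).row r ≠ 0) ∧
    Pairwise fun r r' => LinearIndependent ℝ ![(A.matV θ k₀).row r, (A.matV θ k₀).row r']}

/-- The values of the filters `(v^{k'}_{j,i}, u^k_{i,j})`. -/
abbrev Overlap (A : ConvArch q p) (k k' : Fin q) : Type :=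
  (Fin (A.width k') × Fin A.c × Fin (A.nv k') → ℝ) ×
    (Fin A.c × Fin (A.width k) × Fin (A.nu k) → ℝ)

/-- The part `(V^{k'}, U^k)` of the parameters, given through its filters. -/
def overlap (A : ConvArch q p) (k k' : Fin q) (θ : A.Param) : A.Overlap k k' :=
  (fun t => θ ⟨k', Sum.inr t⟩, fun t => θ ⟨k, Sum.inl t⟩)

end ConvArch

/-- The Euclidean loss `‖z - y‖₂²`. -/
def euclideanLoss {ι : Type*} [Fintype ι] (z y : ι → ℝ) : ℝ := ∑ i, (z i - y i) ^ 2

/-- The empirical risk `(1 / N) ∑ᵢ ℓ(g(θ, xᵢ), yᵢ)` of the data set `(X, Y)`. -/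
noncomputable def empiricalRisk {E F G Y : Type*} (g : E → F → G) (loss : G → Y → ℝ) {N : ℕ}
    (x : Fin N → F) (y : Fin N → Y) (θ : E) : ℝ :=
  (1 / (N : ℝ)) * ∑ i, loss (g θ (x i)) (y i)

/-- `H` is conserved on `Θ` by the gradient flows of the empirical risks of `g`, for any data set:
for every open `Ω ⊆ Θ`, every nonempty finite data set such that the functions `g(·, xᵢ)` are `C²`
on `Ω`, and every solution of `γ' = -∇L(γ)` that lives in `Ω` on a time interval `[0, T]`,
`H` takes the same value at both ends. Only the values of `H` on `Θ` matter. -/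
def IsConservationLaw {E F G Y : Type*} [NormedAddCommGroup E] [InnerProductSpace ℝ E]
    [CompleteSpace E] [NormedAddCommGroup G] [NormedSpace ℝ G]
    (g : E → F → G) (loss : G → Y → ℝ) (Θ : Set E) (H : E → ℝ) : Prop :=
  ∀ Ω : Set E, IsOpen Ω → Ω ⊆ Θ →
  ∀ (N : ℕ) (x : Fin N → F) (y : Fin N → Y), 0 < N →
    (∀ i, ContDiffOn ℝ 2 (fun θ => g θ (x i)) Ω) →
  ∀ (T : ℝ) (γ : ℝ → E), 0 ≤ T →
    (∀ t ∈ Set.Icc 0 T, γ t ∈ Ω) →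
    (∀ t ∈ Set.Icc 0 T, HasDerivWithinAt γ
      (-gradient (empiricalRisk g loss x y) (γ t)) (Set.Icc 0 T) t) →
    H (γ T) = H (γ 0)

/-!
A conserved function `h` of the overlap `(V^{l+1}, U^l)` carries no regularity assumption, so it
cannot be differentiated along gradient flows. Instead the flows are used to move around: if `θ` is
an interior admissible parameter at which the network is smooth in `θ` for some input, then `h` is
unchanged along the gradient flow of any risk built on that input, and after each motion all the
parameters that `h` does not read may be reset. A local flow of a `C¹` field is strictly
differentiable at its base point (`ContDiffAt.exists_flow_hasStrictFDerivAt`), hence so is a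
composition of such motions as a function of the times spent on each. If the initial velocities,
called neutral directions, span, the inverse function theorem for maps with surjective derivative
shows that the reachable points fill a neighbourhood, on which `h` is constant
(`eventually_eq_of_span_isNeutralDirection`).

The neutral directions do span (`ConvArch.span_isNeutralDirection_eq_top`). Only the conditions on
the rows constrain the overlap of an admissible parameter: taking `V^l` and `U^{l+1}` small and the
other `U^k` zero makes every block a small perturbation of the identity, thus an open map, together
with all its neighbours (`ConvArch.eventually_probe_smul`). With `U^{l+1} = 0` and a `V^l` for which
a single neuron is active, one entry of `u^l` moves while `v^{l+1}` stands still. With `V^l` such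
that no neuron of block `l` is active, and one nonzero entry in the filters `u^{l+1}`, the filters of one
hidden channel of block `l + 1` move in the direction of the input, up to a motion of `u^l`; the inputs
allowed here fill a nonempty open set, which spans. So `h` is locally constant on the set `Π` of
overlaps, and constant on its connected components.

For `m ≥ 3` the set `Π` is connected. Filters `u` are free, and the filters `v_j` of one hidden
channel, the others being fixed, have to avoid finitely many subspaces of codimension at least two:
the multiples of rows of the other channels, and the filters equal to a shift of themselves up to
sign. Exchanging one `v_j` at a time, through an intermediate value compatible with two given
families, joins any two points (`IsGenericFamily.eq_of_eventually_eq`).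
-/

open Filter Topology Metric Set

/-! ### Motions along flows and neutral directions -/

/-- A `C¹` vector field has a local flow which is strictly differentiable at the base point, at
time zero, with derivative `(dx, dt) ↦ dx + dt • f x₀`. -/
theorem ContDiffAt.exists_flow_hasStrictFDerivAt {E : Type*} [NormedAddCommGroup E]
    [NormedSpace ℝ E] [CompleteSpace E] {f : E → E} {x₀ : E} (hf : ContDiffAt ℝ 1 f x₀) :
    ∃ (φ : E → ℝ → E) (r ε : ℝ), 0 < r ∧ 0 < ε ∧
      (∀ x ∈ closedBall x₀ r, φ x 0 = x ∧
        ∀ t ∈ Icc (-ε) ε, HasDerivWithinAt (φ x) (f (φ x t)) (Icc (-ε) ε) t) ∧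
      HasStrictFDerivAt (fun q : E × ℝ => φ q.1 q.2)
        (ContinuousLinearMap.fst ℝ E ℝ + (ContinuousLinearMap.snd ℝ E ℝ).smulRight (f x₀))
        (x₀, 0) := by
  obtain ⟨ε, hε, a, r, L, K, hr, hpl⟩ := IsPicardLindelof.of_contDiffAt_one hf
  obtain ⟨φ, hφ, L', hL'⟩ :=
    (hpl 0).exists_forall_mem_closedBall_eq_hasDerivWithinAt_lipschitzOnWith
  simp only [zero_sub, zero_add] at hφ hL'
  have hr' : (0 : ℝ) < r := hr
  refine ⟨φ, r, ε, hr', hε, hφ, ?_⟩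
  have h0ε : Icc (-ε) ε ∈ 𝓝 (0 : ℝ) := Icc_mem_nhds (by linarith) hε
  -- The flow is jointly continuous at the base point.
  have hcont : ContinuousAt (fun q : E × ℝ => φ q.1 q.2) (x₀, 0) := by
    have : ContinuousOn (Function.uncurry φ) (closedBall x₀ r ×ˢ Icc (-ε) ε) :=
      continuousOn_prod_of_continuousOn_lipschitzOnWith _ L'
        (fun x hx t ht => ((hφ x hx).2 t ht).continuousWithinAt) hL'
    exact this.continuousAt (prod_mem_nhds (closedBall_mem_nhds _ hr') h0ε)
  obtain ⟨K', s, hs, hl⟩ := hf.exists_lipschitzOnWith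
  refine .of_isLittleO (Asymptotics.isLittleO_iff.2 fun c hc => ?_)
  have hφ0 : φ x₀ 0 = x₀ := (hφ x₀ (mem_closedBall_self hr'.le)).1
  have hfc : ∀ᶠ y in 𝓝 x₀, ‖f y - f x₀‖ ≤ c / 2 := by
    filter_upwards [hf.continuousAt.eventually (closedBall_mem_nhds (f x₀) (half_pos hc))] with y hy
    simpa [dist_eq_norm] using hy
  have hev : ∀ᶠ q in 𝓝 (x₀, (0 : ℝ)), φ q.1 q.2 ∈ s ∧ ‖f (φ q.1 q.2) - f x₀‖ ≤ c / 2 := by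
    have h2 : ∀ᶠ y in 𝓝 (φ x₀ 0), y ∈ s ∧ ‖f y - f x₀‖ ≤ c / 2 := by
      rw [hφ0]; exact Filter.Eventually.and hs hfc
    exact hcont.eventually h2
  obtain ⟨δ₀, hδ₀, hδ₀'⟩ := Metric.eventually_nhds_iff_ball.1 hev
  obtain ⟨δ, hδ, hδ1, hδ2, hδ3, hδ4⟩ : ∃ δ > 0, δ ≤ δ₀ ∧ δ ≤ r ∧ δ ≤ ε ∧
      K' * L' * δ ≤ c / 2 := by
    refine ⟨min (min δ₀ r) (min ε (c / 2 / (K' * L' + 1))), by positivity, by simp, by simp,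
      by simp, ?_⟩
    have h1 : min (min δ₀ (r : ℝ)) (min ε (c / 2 / (K' * L' + 1))) ≤ c / 2 / (K' * L' + 1) := by
      simp
    have h2 : (0 : ℝ) ≤ K' * L' := by positivity
    calc _ ≤ (K' * L' : ℝ) * (c / 2 / (K' * L' + 1)) := by gcongr
      _ = (K' * L') / (K' * L' + 1) * (c / 2) := by ring
      _ ≤ 1 * (c / 2) := by gcongr; rw [div_le_one (by positivity)]; linarith
      _ = c / 2 := one_mul _
  have hball : ∀ x ∈ ball x₀ δ, ∀ t ∈ Ioo (-δ) δ,
      φ x t ∈ s ∧ ‖f (φ x t) - f x₀‖ ≤ c / 2 := fun x hx t ht => by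
    refine hδ₀' (x, t) ?_
    rw [← ball_prod_same]
    refine ⟨ball_subset_ball hδ1 hx, ball_subset_ball hδ1 ?_⟩
    simpa [abs_lt] using ht
  have hder : ∀ x ∈ ball x₀ δ, ∀ t ∈ Ioo (-δ) δ,
      HasDerivWithinAt (φ x) (f (φ x t)) (Ioo (-δ) δ) t := fun x hx t ht =>
    ((hφ x (ball_subset_closedBall (ball_subset_ball hδ2 hx))).2 t
      ⟨by linarith [ht.1], by linarith [ht.2]⟩).mono
      fun u hu => ⟨by linarith [hu.1], by linarith [hu.2]⟩
  have hN : ball x₀ δ ×ˢ Ioo (-δ) δ ∈ 𝓝 (x₀, (0 : ℝ)) :=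
    prod_mem_nhds (ball_mem_nhds _ hδ) (Ioo_mem_nhds (by linarith) hδ)
  filter_upwards [prod_mem_nhds hN hN]
  rintro ⟨⟨x, t⟩, ⟨y, u⟩⟩ ⟨⟨hx, ht⟩, ⟨hy, hu⟩⟩
  simp only at hx ht hy hu
  have key1 : ‖(φ x t - t • f x₀) - (φ x u - u • f x₀)‖ ≤ c / 2 * ‖t - u‖ := by
    refine (convex_Ioo (-δ) δ).norm_image_sub_le_of_norm_hasDerivWithin_le
      (f := fun τ => φ x τ - τ • f x₀) (f' := fun τ => f (φ x τ) - f x₀)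
      (fun τ hτ => ?_) (fun τ hτ => (hball x hx τ hτ).2) hu ht
    exact ((hder x hx τ hτ).sub
      (((hasDerivAt_id τ).smul_const (f x₀)).hasDerivWithinAt)).congr_deriv (by simp)
  have key2 : ‖(φ x u - φ y u) - (φ x 0 - φ y 0)‖ ≤ K' * L' * ‖x - y‖ * ‖u - 0‖ := by
    refine (convex_Ioo (-δ) δ).norm_image_sub_le_of_norm_hasDerivWithin_le
      (f := fun τ => φ x τ - φ y τ) (f' := fun τ => f (φ x τ) - f (φ y τ))
      (fun τ hτ => (hder x hx τ hτ).sub (hder y hy τ hτ)) (fun τ hτ => ?_) ⟨by linarith, hδ⟩ hu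
    calc _ ≤ K' * ‖φ x τ - φ y τ‖ := hl.norm_sub_le (hball x hx τ hτ).1 (hball y hy τ hτ).1
      _ ≤ K' * (L' * ‖x - y‖) := by
        gcongr
        exact (hL' τ ⟨by linarith [hτ.1], by linarith [hτ.2]⟩).norm_sub_le
          (ball_subset_closedBall (ball_subset_ball hδ2 hx))
          (ball_subset_closedBall (ball_subset_ball hδ2 hy))
      _ = _ := by ring
  rw [(hφ x (ball_subset_closedBall (ball_subset_ball hδ2 hx))).1,
    (hφ y (ball_subset_closedBall (ball_subset_ball hδ2 hy))).1] at key2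
  have hxy : ‖x - y‖ ≤ ‖((x, t) : E × ℝ) - (y, u)‖ :=
    norm_fst_le (((x, t) : E × ℝ) - (y, u))
  have htu : ‖t - u‖ ≤ ‖((x, t) : E × ℝ) - (y, u)‖ :=
    norm_snd_le (((x, t) : E × ℝ) - (y, u))
  have hu' : ‖u - 0‖ ≤ δ := by simpa using (abs_lt.2 hu).le
  calc _ = ‖((φ x t - t • f x₀) - (φ x u - u • f x₀)) + ((φ x u - φ y u) - (x - y))‖ := by
        congr 1
        simp [sub_smul]
        abel
    _ ≤ c / 2 * ‖t - u‖ + K' * L' * ‖x - y‖ * ‖u - 0‖ := norm_add_le_of_le key1 key2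
    _ ≤ c / 2 * ‖t - u‖ + K' * L' * ‖x - y‖ * δ := by gcongr
    _ = c / 2 * ‖t - u‖ + (K' * L' * δ) * ‖x - y‖ := by ring
    _ ≤ c / 2 * ‖((x, t) : E × ℝ) - (y, u)‖ + c / 2 * ‖((x, t) : E × ℝ) - (y, u)‖ := by
        gcongr
    _ = _ := by ring

/-- `w` is a *neutral direction* of `h` at `a` if near `a` there is a family of motions
`b ↦ M (b, t)`, strictly differentiable at `(a, 0)` and with initial velocity `w`, along which `h`
does not change. No regularity of `h` is involved. -/
def IsNeutralDirection {F : Type*} [NormedAddCommGroup F] [NormedSpace ℝ F] (h : F → ℝ)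
    (a w : F) : Prop :=
  ∃ M : F × ℝ → F, M (a, 0) = a ∧
    HasStrictFDerivAt M
      (ContinuousLinearMap.fst ℝ F ℝ + (ContinuousLinearMap.snd ℝ F ℝ).smulRight w) (a, 0) ∧
    ∀ᶠ q in 𝓝 (a, (0 : ℝ)), h (M q) = h q.1

/-- Composing motions along finitely many neutral directions gives a map from the times spent on
each of them that preserves `h`; its derivative is the corresponding linear combination. -/
theorem exists_hasStrictFDerivAt_sum_of_isNeutralDirection {F ι : Type*} [NormedAddCommGroup F]
    [NormedSpace ℝ F] [Fintype ι] {h : F → ℝ} {a : F} {w : ι → F}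
    (hw : ∀ i, IsNeutralDirection h a (w i)) (s : Finset ι) :
    ∃ R : (ι → ℝ) → F, R 0 = a ∧
      HasStrictFDerivAt R
        (∑ i ∈ s, (ContinuousLinearMap.proj (R := ℝ) (φ := fun _ : ι => ℝ) i).smulRight (w i)) 0 ∧
      ∀ᶠ t in 𝓝 (0 : ι → ℝ), h (R t) = h a := by
  classical
  induction s using Finset.induction_on with
  | empty => exact ⟨fun _ => a, rfl, by simpa using hasStrictFDerivAt_const a _, by simp⟩
  | insert i s his ih =>
    obtain ⟨R, hR0, hR, hRh⟩ := ih
    obtain ⟨M, hM0, hM, hMh⟩ := hw i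
    have hpair : HasStrictFDerivAt (fun t : ι → ℝ => (R t, t i)) _ 0 :=
      hR.prodMk (ContinuousLinearMap.proj (R := ℝ) (φ := fun _ : ι => ℝ) i).hasStrictFDerivAt
    have hval : (R 0, (0 : ι → ℝ) i) = (a, 0) := by simp [hR0]
    refine ⟨fun t => M (R t, t i), by simp [hR0, hM0], ?_, ?_⟩
    · rw [← hval] at hM
      refine (hM.comp 0 hpair).congr_fderiv (ContinuousLinearMap.ext fun t => ?_)
      rw [Finset.sum_insert his, add_comm]
      simp
    · have hc : Tendsto (fun t : ι → ℝ => (R t, t i)) (𝓝 0) (𝓝 (a, 0)) := by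
        rw [← hval]; exact hpair.continuousAt
      filter_upwards [hc.eventually hMh, hRh] with t h1 h2
      rw [h1, h2]

/-- A function whose neutral directions at `a` span the whole space is constant near `a`. -/
theorem eventually_eq_of_span_isNeutralDirection {F : Type*} [NormedAddCommGroup F]
    [NormedSpace ℝ F] [FiniteDimensional ℝ F] {h : F → ℝ} {a : F}
    (hspan : Submodule.span ℝ {w | IsNeutralDirection h a w} = ⊤) :
    ∀ᶠ b in 𝓝 a, h b = h a := by
  obtain ⟨b, hbs, hb⟩ := exists_linearIndependent ℝ {w | IsNeutralDirection h a w}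
  have hfin : Finite b := hb.2.setFinite
  have := Fintype.ofFinite b
  have : CompleteSpace F := FiniteDimensional.complete ℝ F
  obtain ⟨R, hR0, hR, hRh⟩ := exists_hasStrictFDerivAt_sum_of_isNeutralDirection
    (w := fun i : b => (i : F)) (fun i => hbs i.2) Finset.univ
  have hsurj := hR.map_nhds_eq_of_surj (by
    rw [eq_top_iff, ← hspan, ← hb.1, Submodule.span_le]
    intro w hw
    classical
    refine ⟨Pi.single ⟨w, hw⟩ 1, ?_⟩
    simp [Pi.single_apply, ite_smul])
  rw [hR0] at hsurj
  rw [← hsurj]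
  exact hRh

/-! ### Gradient flows and conservation laws -/

/-- The gradient of a `C²` function is `C¹`. -/
theorem ContDiffAt.gradient_of_two {E : Type*} [NormedAddCommGroup E] [InnerProductSpace ℝ E]
    [CompleteSpace E] {L : E → ℝ} {x : E} (hL : ContDiffAt ℝ 2 L x) :
    ContDiffAt ℝ 1 (gradient L) x := by
  -- The Riesz isomorphism is declared as conjugate-linear; over `ℝ` it is linear.
  let R : (E →L[ℝ] ℝ) →ₗ[ℝ] E :=
    { toFun := fun φ => (InnerProductSpace.toDual ℝ E).symm φ
      map_add' := by simp
      map_smul' := by simp }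
  let R' : (E →L[ℝ] ℝ) →L[ℝ] E := ⟨R, (InnerProductSpace.toDual ℝ E).symm.continuous⟩
  exact R'.contDiff.contDiffAt.comp x (hL.fderiv_right (m := 1) (by norm_num))

/-- Gradient flows of risks over a single datum realise neutral directions: the unread part of
the parameter can be reset, by means of a section of `P`, before each motion. -/
theorem IsConservationLaw.isNeutralDirection {E D G Y W : Type*} [NormedAddCommGroup E]
    [InnerProductSpace ℝ E] [CompleteSpace E] [NormedAddCommGroup G] [NormedSpace ℝ G]
    [NormedAddCommGroup W] [NormedSpace ℝ W] {g : E → D → G} {loss : G → Y → ℝ} {Θ : Set E}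
    {h : W → ℝ} {P : E →L[ℝ] W} {s : W →L[ℝ] E} (hs : ∀ w, P (s w) = w)
    (hcons : IsConservationLaw g loss Θ fun θ => h (P θ)) {θ₀ : E} (hΘ : Θ ∈ 𝓝 θ₀) {x : D} {y : Y}
    (hg : ContDiffAt ℝ 2 (fun θ => g θ x) θ₀)
    (hL : ContDiffAt ℝ 2 (empiricalRisk g loss (fun _ : Fin 1 => x) fun _ => y) θ₀) :
    IsNeutralDirection h (P θ₀)
      (P (-gradient (empiricalRisk g loss (fun _ : Fin 1 => x) fun _ => y) θ₀)) := by
  obtain ⟨φ, r, ε, hr, hε, hφ, hstrict⟩ := hL.gradient_of_two.neg.exists_flow_hasStrictFDerivAt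
  have hφ0 : φ θ₀ 0 = θ₀ := (hφ θ₀ (mem_closedBall_self hr.le)).1
  obtain ⟨u, hu, hug⟩ : ∃ u ∈ 𝓝 θ₀, ContDiffOn ℝ 2 (fun θ => g θ x) u :=
    hg.contDiffOn le_rfl (by simp)
  obtain ⟨Ω, hΩ, hΩo, hθΩ⟩ := _root_.mem_nhds_iff.1 (inter_mem hu hΘ)
  have hev : ∀ᶠ q in 𝓝 (θ₀, (0 : ℝ)), φ q.1 q.2 ∈ Ω :=
    hstrict.continuousAt.eventually (by simpa [hφ0] using hΩo.mem_nhds hθΩ)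
  obtain ⟨δ₀, hδ₀, hδ₀'⟩ := Metric.eventually_nhds_iff_ball.1 hev
  obtain ⟨δ, hδ, hδ1, hδ2, hδ3⟩ : ∃ δ > 0, δ ≤ δ₀ ∧ δ ≤ r ∧ δ ≤ ε :=
    ⟨min δ₀ (min r ε), by positivity, by simp, by simp, by simp⟩
  have hmem : ∀ θ ∈ ball θ₀ δ, ∀ t ∈ Ioo (-δ) δ, φ θ t ∈ Ω := fun θ hθ t ht => by
    refine hδ₀' (θ, t) ?_
    rw [← ball_prod_same]
    refine ⟨ball_subset_ball hδ1 hθ, ball_subset_ball hδ1 ?_⟩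
    simpa [abs_lt] using ht
  have hinv : ∀ θ ∈ ball θ₀ δ, ∀ t₁ ∈ Ioo (-δ) δ, ∀ t₂ ∈ Ioo (-δ) δ, t₁ ≤ t₂ →
      h (P (φ θ t₂)) = h (P (φ θ t₁)) := fun θ hθ t₁ h₁ t₂ h₂ h12 => by
    have := hcons Ω hΩo (fun z hz => (hΩ hz).2) 1 (fun _ => x) (fun _ => y) one_pos
      (fun _ => hug.mono fun z hz => (hΩ hz).1) (t₂ - t₁) (fun τ => φ θ (t₁ + τ))
      (by linarith)
      (fun τ hτ => hmem θ hθ _ ⟨by linarith [hτ.1, h₁.1], by linarith [hτ.2, h₂.2]⟩)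
      (fun τ hτ => by
        have h1 := (hφ θ (ball_subset_closedBall (ball_subset_ball hδ2 hθ))).2 (t₁ + τ)
          ⟨by linarith [hτ.1, h₁.1], by linarith [hτ.2, h₂.2]⟩
        have h2 : HasDerivWithinAt (fun τ => t₁ + τ) 1 (Icc 0 (t₂ - t₁)) τ :=
          ((hasDerivAt_id τ).const_add t₁).hasDerivWithinAt
        have h3 := h1.scomp τ h2 (fun v hv =>
          ⟨by linarith [hv.1, h₁.1], by linarith [hv.2, h₂.2]⟩)
        exact h3.congr_deriv (one_smul _ _))
    simpa using this
  have hin : ContinuousAt (fun q : W × ℝ => (θ₀ + s (q.1 - P θ₀), q.2)) (P θ₀, 0) := by fun_prop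
  have hval : (θ₀ + s (P θ₀ - P θ₀), (0 : ℝ)) = (θ₀, 0) := by simp
  refine ⟨fun q => P (φ (θ₀ + s (q.1 - P θ₀)) q.2), by simp [hφ0], ?_, ?_⟩
  · have hA : HasStrictFDerivAt (fun q : W × ℝ => (θ₀ + s (q.1 - P θ₀), q.2))
        ((s.comp (ContinuousLinearMap.fst ℝ W ℝ)).prod (ContinuousLinearMap.snd ℝ W ℝ))
        (P θ₀, 0) := by
      refine HasStrictFDerivAt.prodMk ?_ hasStrictFDerivAt_snd
      exact ((s.hasStrictFDerivAt).comp (P θ₀, (0 : ℝ))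
        (hasStrictFDerivAt_fst.sub_const _)).const_add _
    rw [← hval] at hstrict
    refine (P.hasStrictFDerivAt.comp _ (hstrict.comp (P θ₀, (0 : ℝ)) hA)).congr_fderiv ?_
    refine ContinuousLinearMap.ext fun q => ?_
    simp [hs]
  · have hN : ∀ᶠ q : W × ℝ in 𝓝 (P θ₀, 0), (θ₀ + s (q.1 - P θ₀), q.2) ∈
        ball θ₀ δ ×ˢ Ioo (-δ) δ := by
      refine hin ?_
      simp only [hval]
      exact prod_mem_nhds (ball_mem_nhds _ hδ) (Ioo_mem_nhds (by linarith) hδ)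
    filter_upwards [hN]
    rintro ⟨b, t⟩ ⟨hb, ht⟩
    simp only at hb ht ⊢
    have h0 : (0 : ℝ) ∈ Ioo (-δ) δ := ⟨by linarith, hδ⟩
    have hb0 : h (P (φ (θ₀ + s (b - P θ₀)) 0)) = h b := by
      rw [(hφ _ (ball_subset_closedBall (ball_subset_ball hδ2 hb))).1]
      simp [hs]
    rw [← hb0]
    rcases le_total 0 t with h0t | h0t
    · exact hinv _ hb 0 h0 t ht h0t
    · exact (hinv _ hb t ht 0 h0 h0t).symm

/-! ### Regularity and openness of the network -/

namespace ConvArch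

variable {q p : ℕ}

section Regularity

theorem contDiff_matU (A : ConvArch q p) (k : Fin q) (r s) {n : WithTop ℕ∞} :
    ContDiff ℝ n fun θ : A.Param => A.matU θ k r s := by
  simp only [matU, Matrix.of_apply, Matrix.circulant_apply, pad]
  split_ifs <;> fun_prop

theorem contDiff_matV (A : ConvArch q p) (k : Fin q) (r s) {n : WithTop ℕ∞} :
    ContDiff ℝ n fun θ : A.Param => A.matV θ k r s := by
  simp only [matV, Matrix.of_apply, Matrix.circulant_apply, pad]
  split_ifs <;> fun_prop

theorem continuous_matU (A : ConvArch q p) (k : Fin q) (r s) :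
    Continuous fun θ : A.Param => A.matU θ k r s :=
  (A.contDiff_matU k r s (n := 0)).continuous

theorem continuous_matV (A : ConvArch q p) (k : Fin q) (r s) :
    Continuous fun θ : A.Param => A.matV θ k r s :=
  (A.contDiff_matV k r s (n := 0)).continuous

variable [NeZero p]

/-- The feature vector after the first `n` blocks. -/
noncomputable def partialNet (A : ConvArch q p) (θ : A.Param) (x : A.Feat) : ℕ → A.Feat
  | 0 => x
  | n + 1 => if h : n < q then A.block θ ⟨n, h⟩ (A.partialNet θ x n) else A.partialNet θ x n

theorem net_eq_partialNet (A : ConvArch q p) (θ : A.Param) (x : A.Feat) :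
    A.net θ x = A.partialNet θ x q := by
  have key : ∀ n (hn : n ≤ q),
      Fin.foldl n (fun z k => A.block θ (k.castLE hn) z) x = A.partialNet θ x n := by
    intro n
    induction n with
    | zero => intro _; simp [partialNet]
    | succ n ih =>
      intro hn
      rw [Fin.foldl_succ_last, partialNet, dif_pos (by omega), ← ih (by omega)]
      rfl
  exact key q le_rfl

theorem contDiffAt_block (A : ConvArch q p) (k : Fin q) {z : A.Param → A.Feat} {θ₀ : A.Param}
    {n : WithTop ℕ∞} (hz : ContDiffAt ℝ n z θ₀)
    (h : ∀ r, (A.matV θ₀ k).mulVec (z θ₀) r ≠ 0) :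
    ContDiffAt ℝ n (fun θ => A.block θ k (z θ)) θ₀ := by
  rw [contDiffAt_pi] at hz ⊢
  have hpre : ∀ r, ContDiffAt ℝ n (fun θ => (A.matV θ k).mulVec (z θ) r) θ₀ := fun r => by
    simp only [Matrix.mulVec, dotProduct]
    exact ContDiffAt.sum fun s _ => (A.contDiff_matV k r s).contDiffAt.mul (hz s)
  have hmax : ∀ r, ContDiffAt ℝ n (fun θ => max ((A.matV θ k).mulVec (z θ) r) 0) θ₀ := fun r => by
    rcases lt_or_gt_of_ne (h r) with hr | hr
    · refine contDiffAt_const (c := (0 : ℝ)) |>.congr_of_eventuallyEq ?_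
      filter_upwards [(hpre r).continuousAt.eventually (gt_mem_nhds hr)] with θ hθ
      exact max_eq_right (le_of_lt hθ)
    · refine (hpre r).congr_of_eventuallyEq ?_
      filter_upwards [(hpre r).continuousAt.eventually (lt_mem_nhds hr)] with θ hθ
      exact max_eq_left (le_of_lt hθ)
  intro i
  simp only [block, Pi.add_apply]
  refine (hz i).add ?_
  conv => arg 3; ext θ; rw [Matrix.mulVec, dotProduct]
  exact ContDiffAt.sum fun r _ => (A.contDiff_matU k i r).contDiffAt.mul (hmax r)

theorem contDiffAt_net (A : ConvArch q p) {x : A.Feat} {θ₀ : A.Param} {n : WithTop ℕ∞}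
    (h : ∀ k r, (A.matV θ₀ k).mulVec (A.partialNet θ₀ x k) r ≠ 0) :
    ContDiffAt ℝ n (fun θ => A.net θ x) θ₀ := by
  simp only [net_eq_partialNet]
  have : ∀ m, ContDiffAt ℝ n (fun θ => A.partialNet θ x m) θ₀ := by
    intro m
    induction m with
    | zero => exact contDiffAt_const
    | succ m ih =>
      simp only [partialNet]
      split_ifs with hm
      · exact A.contDiffAt_block ⟨m, hm⟩ ih (h ⟨m, hm⟩)
      · exact ih
  exact this q

end Regularity

section Openness

variable [NeZero p]

/-- A bound for the Lipschitz constant of the residual part of block `k`. -/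
noncomputable def residualBound (A : ConvArch q p) (θ : A.Param) (k : Fin q) : ℝ :=
  ∑ i, ∑ r, |A.matU θ k i r| * ∑ s, |A.matV θ k r s|

theorem continuous_residualBound (A : ConvArch q p) (k : Fin q) :
    Continuous fun θ : A.Param => A.residualBound θ k :=
  continuous_finsetSum _ fun i _ => continuous_finsetSum _ fun r _ =>
    (A.continuous_matU k i r).abs.mul
      (continuous_finsetSum _ fun s _ => (A.continuous_matV k r s).abs)

theorem norm_block_sub_sub_le (A : ConvArch q p) (θ : A.Param) (k : Fin q) (x y : A.Feat) :
    ‖A.block θ k x - A.block θ k y - (x - y)‖ ≤ A.residualBound θ k * ‖x - y‖ := by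
  have h0 : ∀ i, 0 ≤ ∑ r, |A.matU θ k i r| * ∑ s, |A.matV θ k r s| := fun i => by positivity
  rw [residualBound, pi_norm_le_iff_of_nonneg
    (mul_nonneg (Finset.sum_nonneg fun i _ => h0 i) (norm_nonneg _))]
  intro i
  have hV : ∀ r, |max ((A.matV θ k).mulVec x r) 0 - max ((A.matV θ k).mulVec y r) 0| ≤
      (∑ s, |A.matV θ k r s|) * ‖x - y‖ := fun r => by
    refine (abs_max_sub_max_le_abs _ _ _).trans ?_
    rw [← Pi.sub_apply, ← Matrix.mulVec_sub, Matrix.mulVec, dotProduct, Finset.sum_mul]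
    refine (Finset.abs_sum_le_sum_abs _ _).trans (Finset.sum_le_sum fun s _ => ?_)
    rw [abs_mul]
    gcongr
    exact norm_le_pi_norm (x - y) s
  calc _ = |∑ r, A.matU θ k i r *
        (max ((A.matV θ k).mulVec x r) 0 - max ((A.matV θ k).mulVec y r) 0)| := by
        simp only [block, Matrix.mulVec, dotProduct, Pi.sub_apply, Pi.add_apply, mul_sub,
          Finset.sum_sub_distrib, Real.norm_eq_abs]
        congr 1
        ring
    _ ≤ ∑ r, |A.matU θ k i r| * ((∑ s, |A.matV θ k r s|) * ‖x - y‖) := by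
        refine (Finset.abs_sum_le_sum_abs _ _).trans (Finset.sum_le_sum fun r _ => ?_)
        rw [abs_mul]
        gcongr
        exact hV r
    _ = (∑ r, |A.matU θ k i r| * ∑ s, |A.matV θ k r s|) * ‖x - y‖ := by
        rw [Finset.sum_mul]
        exact Finset.sum_congr rfl fun r _ => by ring
    _ ≤ _ := by
        gcongr
        exact Finset.single_le_sum (f := fun i => ∑ r, |A.matU θ k i r| * ∑ s, |A.matV θ k r s|)
          (fun i _ => h0 i) (Finset.mem_univ i)

/-- A block whose residual part is a contraction is an open map. -/
theorem isOpenMap_block (A : ConvArch q p) {θ : A.Param} {k : Fin q}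
    (h : A.residualBound θ k < 1) : IsOpenMap (A.block θ k) := by
  have h0 : 0 ≤ A.residualBound θ k :=
    Finset.sum_nonneg fun i _ => Finset.sum_nonneg fun r _ => by positivity
  let inv : (ContinuousLinearMap.id ℝ A.Feat).NonlinearRightInverse :=
    { toFun := id
      nnnorm := 1
      bound' := fun y => by simp
      right_inv' := fun y => rfl }
  have happ : ApproximatesLinearOn (A.block θ k) (ContinuousLinearMap.id ℝ A.Feat) univ
      (.mk (A.residualBound θ k) h0) :=
    fun x _ y _ => A.norm_block_sub_sub_le θ k x y
  intro s hs
  refine (happ.mono_set (subset_univ s)).open_image inv hs (Or.inr ?_)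
  rw [← NNReal.coe_lt_coe]
  simpa [inv] using h

/-- Parameters whose residual parts are contractions are interior points of the admissible set,
provided that they satisfy the conditions on the rows. -/
theorem admissible_mem_nhds (A : ConvArch q p) {k₀ : Fin q} {θ₀ : A.Param}
    (hres : ∀ k, A.residualBound θ₀ k < 1) (hrow : ∀ k r, (A.matV θ₀ k).row r ≠ 0)
    (hpair : Pairwise fun r r' =>
      LinearIndependent ℝ ![(A.matV θ₀ k₀).row r, (A.matV θ₀ k₀).row r']) :
    A.admissible k₀ ∈ 𝓝 θ₀ := by
  have hcont : ∀ k r, Continuous fun θ : A.Param => (A.matV θ k).row r := fun k r =>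
    continuous_pi fun s => A.continuous_matV k r s
  have h1 : ∀ᶠ θ in 𝓝 θ₀, ∀ k, A.residualBound θ k < 1 :=
    eventually_all.2 fun k =>
      (A.continuous_residualBound k).continuousAt.eventually (gt_mem_nhds (hres k))
  have h2 : ∀ᶠ θ in 𝓝 θ₀, ∀ k r, (A.matV θ k).row r ≠ 0 :=
    eventually_all.2 fun k => eventually_all.2 fun r =>
      (hcont k r).continuousAt.eventually_ne (hrow k r)
  have h3 : ∀ᶠ θ in 𝓝 θ₀, ∀ r r', r ≠ r' →
      LinearIndependent ℝ ![(A.matV θ k₀).row r, (A.matV θ k₀).row r'] := by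
    refine eventually_all.2 fun r => eventually_all.2 fun r' => ?_
    by_cases hrr : r = r'
    · simp [hrr]
    · have hc : Continuous fun θ : A.Param =>
          ![(A.matV θ k₀).row r, (A.matV θ k₀).row r'] := by
        refine continuous_pi fun i => ?_
        fin_cases i
        · exact hcont k₀ r
        · exact hcont k₀ r'
      filter_upwards [hc.continuousAt.eventually
        (isOpen_setOfPred_linearIndependent.mem_nhds (hpair hrr))] with θ hθ _
      exact hθ
  filter_upwards [h1, h2, h3] with θ a b c
  exact ⟨fun k => A.isOpenMap_block (a k), b, fun r r' h => c r r' h⟩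

end Openness

section TwoBlocks

variable [NeZero p]

theorem block_eq_self (A : ConvArch q p) {θ : A.Param} {k : Fin q} (h : A.matU θ k = 0)
    (x : A.Feat) : A.block θ k x = x := by
  simp [block, h]

/-- If only the blocks `l` and `l + 1` are active, the first `n` blocks compute one of three
functions. -/
theorem partialNet_eq (A : ConvArch q p) {l : ℕ} (hl : l + 1 < q) {θ : A.Param}
    (hU : ∀ k : Fin q, (k : ℕ) ≠ l → (k : ℕ) ≠ l + 1 → A.matU θ k = 0) (x : A.Feat) (n : ℕ) :
    A.partialNet θ x n = if n ≤ l then x else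
      if n = l + 1 then A.block θ ⟨l, Nat.lt_of_succ_lt hl⟩ x else
        A.block θ ⟨l + 1, hl⟩ (A.block θ ⟨l, Nat.lt_of_succ_lt hl⟩ x) := by
  induction n with
  | zero => simp [partialNet]
  | succ n ih =>
    rw [partialNet, ih]
    rcases lt_trichotomy n l with h | rfl | h
    · rw [dif_pos (by omega), if_pos h.le, if_pos (by omega), block_eq_self]
      exact hU _ (by simp; omega) (by simp; omega)
    · rw [dif_pos (by omega)]; simp
    · rcases eq_or_ne n (l + 1) with rfl | h'
      · rw [dif_pos hl]; simp
      · rw [if_neg (by omega), if_neg h', if_neg (by omega), if_neg (by omega)]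
        split_ifs with hn
        · exact A.block_eq_self (hU _ (by simp; omega) (by simpa using h')) _
        · rfl

theorem net_eq_block_block (A : ConvArch q p) {l : ℕ} (hl : l + 1 < q) {θ : A.Param}
    (hU : ∀ k : Fin q, (k : ℕ) ≠ l → (k : ℕ) ≠ l + 1 → A.matU θ k = 0) (x : A.Feat) :
    A.net θ x = A.block θ ⟨l + 1, hl⟩ (A.block θ ⟨l, Nat.lt_of_succ_lt hl⟩ x) := by
  rw [net_eq_partialNet, A.partialNet_eq hl hU, if_neg (by omega), if_neg (by omega)]

end TwoBlocks

end ConvArch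

/-! ### The gradient of a single output -/

namespace ConvArch

variable {q p : ℕ}

/-- Reading off the filters `(v^{k'}, u^k)`, as a continuous linear map. -/
noncomputable def overlapL (A : ConvArch q p) (k k' : Fin q) : A.Param →L[ℝ] A.Overlap k k' :=
  LinearMap.toContinuousLinearMap
    { toFun := A.overlap k k'
      map_add' := fun _ _ => rfl
      map_smul' := fun _ _ => rfl }

/-- The parameter obtained from `θ` by replacing the filters `(v^{k'}, u^k)`. -/
noncomputable def withOverlap (A : ConvArch q p) (k k' : Fin q) (w : A.Overlap k k')
    (θ : A.Param) : A.Param :=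
  WithLp.toLp 2 (Function.extend (fun t => (⟨k', Sum.inr t⟩ : A.ParamIdx)) w.1
    (Function.extend (fun t => (⟨k, Sum.inl t⟩ : A.ParamIdx)) w.2 θ))

theorem withOverlap_inr (A : ConvArch q p) (k k' : Fin q) (w : A.Overlap k k') (θ : A.Param) (t) :
    A.withOverlap k k' w θ ⟨k', Sum.inr t⟩ = w.1 t := by
  have hinr : Function.Injective fun t => (⟨k', Sum.inr t⟩ : A.ParamIdx) := fun t t' h => by
    simpa using h
  exact hinr.extend_apply w.1 _ t

theorem withOverlap_inl (A : ConvArch q p) (k k' : Fin q) (w : A.Overlap k k') (θ : A.Param) (t) :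
    A.withOverlap k k' w θ ⟨k, Sum.inl t⟩ = w.2 t := by
  have hinl : Function.Injective fun t => (⟨k, Sum.inl t⟩ : A.ParamIdx) := fun t t' h => by
    simpa using h
  refine (Function.extend_apply' _ _ _ ?_).trans (hinl.extend_apply w.2 _ t)
  rintro ⟨t', ht'⟩
  injection ht' with h1 h2
  subst h1
  simp at h2

theorem withOverlap_inr_of_ne (A : ConvArch q p) {k k' m : Fin q} (hm : m ≠ k')
    (w : A.Overlap k k') (θ : A.Param) (t) :
    A.withOverlap k k' w θ ⟨m, Sum.inr t⟩ = θ ⟨m, Sum.inr t⟩ := by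
  refine (Function.extend_apply' _ _ _ ?_).trans (Function.extend_apply' _ _ _ ?_)
  · rintro ⟨t', ht'⟩
    injection ht' with h1 h2
    exact hm h1.symm
  · rintro ⟨t', ht'⟩
    injection ht' with h1 h2
    subst h1
    simp at h2

theorem overlap_withOverlap (A : ConvArch q p) (k k' : Fin q) (w : A.Overlap k k')
    (θ : A.Param) : A.overlap k k' (A.withOverlap k k' w θ) = w :=
  Prod.ext (funext fun t => A.withOverlap_inr k k' w θ t)
    (funext fun t => A.withOverlap_inl k k' w θ t)

theorem exists_overlapL_rightInverse (A : ConvArch q p) (k k' : Fin q) :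
    ∃ s : A.Overlap k k' →L[ℝ] A.Param, ∀ w, A.overlapL k k' (s w) = w := by
  obtain ⟨s, hs⟩ := (A.overlapL k k').exists_rightInverse_of_surjective
    (LinearMap.range_eq_top.2 fun w => ⟨_, A.overlap_withOverlap k k' w 0⟩)
  exact ⟨s, fun w => DFunLike.congr_fun hs w⟩

variable [NeZero p]

/-- A single datum whose residual is a multiple of the basis vector `e_r` makes the parameters
move in the direction of the gradient of the `r`-th output. -/
theorem isNeutralDirection_fderiv_net (A : ConvArch q p) {k k' k₀ : Fin q}
    {h : A.Overlap k k' → ℝ}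
    (hcons : IsConservationLaw A.net euclideanLoss (A.admissible k₀)
      (fun θ => h (A.overlap k k' θ)))
    {θ₀ : A.Param} (hΘ : A.admissible k₀ ∈ 𝓝 θ₀) {x : A.Feat}
    (hx : ∀ k r, (A.matV θ₀ k).mulVec (A.partialNet θ₀ x k) r ≠ 0) (r : Fin A.c × ZMod p) :
    IsNeutralDirection h (A.overlap k k' θ₀)
      (fun t => fderiv ℝ (fun θ => A.net θ x r) θ₀ (EuclideanSpace.single ⟨k', Sum.inr t⟩ 1),
       fun t => fderiv ℝ (fun θ => A.net θ x r) θ₀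
        (EuclideanSpace.single ⟨k, Sum.inl t⟩ 1)) := by
  obtain ⟨s, hs⟩ := A.exists_overlapL_rightInverse k k'
  have hg : ContDiffAt ℝ 2 (fun θ => A.net θ x) θ₀ := A.contDiffAt_net hx
  have hgi : ∀ i, ContDiffAt ℝ 2 (fun θ => A.net θ x i) θ₀ := contDiffAt_pi.1 hg
  -- The residual is `e_r / 2`; the factor `2` from the square then disappears.
  set y : A.Feat := A.net θ₀ x + Pi.single r (1 / 2) with hy
  have hrisk : empiricalRisk A.net euclideanLoss (fun _ : Fin 1 => x) (fun _ => y) =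
      fun θ => ∑ i, (A.net θ x i - y i) ^ 2 := by
    funext θ
    simp [empiricalRisk, euclideanLoss]
  have hL : ContDiffAt ℝ 2
      (empiricalRisk A.net euclideanLoss (fun _ : Fin 1 => x) (fun _ => y)) θ₀ := by
    rw [hrisk]
    exact ContDiffAt.sum fun i _ => ((hgi i).sub contDiffAt_const).pow 2
  have hd : HasFDerivAt (empiricalRisk A.net euclideanLoss (fun _ : Fin 1 => x) (fun _ => y))
      (-fderiv ℝ (fun θ => A.net θ x r) θ₀) θ₀ := by
    rw [hrisk]
    have h1 : ∀ i ∈ Finset.univ, HasFDerivAt (fun θ => (A.net θ x i - y i) ^ 2)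
        ((2 * (A.net θ₀ x i - y i)) • fderiv ℝ (fun θ => A.net θ x i) θ₀) θ₀ := fun i _ => by
      have := ((((hgi i).differentiableAt (by norm_num)).hasFDerivAt).sub_const (y i)).pow 2
      simpa using this
    refine (HasFDerivAt.fun_sum h1).congr_fderiv ?_
    rw [Finset.sum_eq_single r]
    · simp [hy]
    · intro i _ hi
      simp [hy, hi]
    · simp
  have key := IsConservationLaw.isNeutralDirection (P := A.overlapL k k') hs hcons hΘ hg hL
  have hcoord : ∀ idx, (-gradient (empiricalRisk A.net euclideanLoss (fun _ : Fin 1 => x)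
      (fun _ => y)) θ₀) idx =
      fderiv ℝ (fun θ => A.net θ x r) θ₀ (EuclideanSpace.single idx 1) := fun idx => by
    rw [hd.hasGradientAt.gradient]
    have h2 : inner ℝ ((InnerProductSpace.toDual ℝ A.Param).symm
        (-fderiv ℝ (fun θ => A.net θ x r) θ₀)) (EuclideanSpace.single idx (1 : ℝ)) =
        -fderiv ℝ (fun θ => A.net θ x r) θ₀ (EuclideanSpace.single idx 1) := by
      rw [InnerProductSpace.toDual_symm_apply]
      rfl
    rw [EuclideanSpace.inner_single_right] at h2
    simp only [one_mul, conj_trivial] at h2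
    rw [PiLp.neg_apply, h2, neg_neg]
  have hvel : A.overlapL k k' (-gradient (empiricalRisk A.net euclideanLoss (fun _ : Fin 1 => x)
      (fun _ => y)) θ₀) = (_, _) :=
    Prod.ext (funext fun t => hcoord _) (funext fun t => hcoord _)
  rw [hvel] at key
  exact key

theorem fderiv_net_apply (A : ConvArch q p) {θ₀ : A.Param} {x : A.Feat}
    (hx : ∀ k r, (A.matV θ₀ k).mulVec (A.partialNet θ₀ x k) r ≠ 0) {r : Fin A.c × ZMod p}
    {e : A.Param} {d : ℝ} (hd : HasDerivAt (fun τ : ℝ => A.net (θ₀ + τ • e) x r) d 0) :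
    fderiv ℝ (fun θ => A.net θ x r) θ₀ e = d := by
  have hg : ContDiffAt ℝ 1 (fun θ => A.net θ x r) θ₀ := contDiffAt_pi.1 (A.contDiffAt_net hx) r
  have h1 := ((hg.differentiableAt (by norm_num)).hasFDerivAt.hasLineDerivAt e)
  exact HasDerivAt.unique h1 hd

end ConvArch

/-! ### Small blocks -/

/-- Finitely many hyperplanes through the origin have open complement. -/
theorem isOpen_setOf_dotProduct_ne_zero {ι : Type*} [Fintype ι] {s : Set (ι → ℝ)}
    (hs : s.Finite) : IsOpen {x : ι → ℝ | ∀ v ∈ s, v ⬝ᵥ x ≠ 0} := by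
  have h : {x : ι → ℝ | ∀ v ∈ s, v ⬝ᵥ x ≠ 0} = ⋂ v ∈ s, {x | v ⬝ᵥ x ≠ 0} := by
    ext x; simp
  rw [h]
  exact hs.isOpen_biInter fun v _ =>
    isOpen_ne_fun (continuous_const.dotProduct continuous_id) continuous_const

/-- Finitely many hyperplanes through the origin have dense complement. -/
theorem dense_setOf_dotProduct_ne_zero {ι : Type*} [Fintype ι] {s : Set (ι → ℝ)}
    (hs : s.Finite) (h0 : ∀ v ∈ s, v ≠ 0) : Dense {x : ι → ℝ | ∀ v ∈ s, v ⬝ᵥ x ≠ 0} := by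
  induction s, hs using Set.Finite.induction_on with
  | empty => simp
  | @insert v s hv hs ih =>
    have h1 : Dense {x : ι → ℝ | v ⬝ᵥ x ≠ 0} := by
      have hker : ((LinearMap.ker (dotProductBilin ℝ ℝ v) : Submodule ℝ (ι → ℝ)) : Set (ι → ℝ))ᶜ =
          {x : ι → ℝ | v ⬝ᵥ x ≠ 0} := by
        ext x; simp
      rw [← hker, ← interior_eq_empty_iff_dense_compl]
      by_contra hne
      have htop := Submodule.eq_top_of_nonempty_interior' _ (nonempty_iff_ne_empty.2 hne)
      have : v ∈ LinearMap.ker (dotProductBilin ℝ ℝ v) := htop ▸ Submodule.mem_top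
      exact h0 v (mem_insert _ _) (by simpa using this)
    have h2 := h1.inter_of_isOpen_right (ih fun w hw => h0 w (mem_insert_of_mem _ hw))
      (isOpen_setOf_dotProduct_ne_zero hs)
    refine h2.mono ?_
    rintro x ⟨hx1, hx2⟩ w (rfl | hw)
    exacts [hx1, hx2 w hw]

namespace ConvArch

variable {q p : ℕ}

section Linear

theorem matU_add_smul (A : ConvArch q p) (θ e : A.Param) (τ : ℝ) (k : Fin q) :
    A.matU (θ + τ • e) k = A.matU θ k + τ • A.matU e k := by
  ext r s
  simp only [matU, Matrix.of_apply, Matrix.circulant_apply, pad, Matrix.add_apply,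
    Matrix.smul_apply]
  split_ifs <;> simp

theorem matV_add_smul (A : ConvArch q p) (θ e : A.Param) (τ : ℝ) (k : Fin q) :
    A.matV (θ + τ • e) k = A.matV θ k + τ • A.matV e k := by
  ext r s
  simp only [matV, Matrix.of_apply, Matrix.circulant_apply, pad, Matrix.add_apply,
    Matrix.smul_apply]
  split_ifs <;> simp

theorem matU_single_inr (A : ConvArch q p) (k k' : Fin q) (t) :
    A.matU (EuclideanSpace.single ⟨k', Sum.inr t⟩ 1) k = 0 := by
  ext r s
  simp [matU, Matrix.circulant_apply, pad, Sigma.ext_iff]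
  intro _ h
  subst h
  simp

theorem matV_single_inl (A : ConvArch q p) (k k' : Fin q) (t) :
    A.matV (EuclideanSpace.single ⟨k', Sum.inl t⟩ 1) k = 0 := by
  ext r s
  simp [matV, Matrix.circulant_apply, pad, Sigma.ext_iff]
  intro _ h
  subst h
  simp

theorem matU_single_of_ne (A : ConvArch q p) {k k' : Fin q} (h : k ≠ k') (t) :
    A.matU (EuclideanSpace.single ⟨k', t⟩ 1) k = 0 := by
  ext r s
  simp [matU, Matrix.circulant_apply, pad, Sigma.ext_iff, h]

theorem matV_single_of_ne (A : ConvArch q p) {k k' : Fin q} (h : k ≠ k') (t) :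
    A.matV (EuclideanSpace.single ⟨k', t⟩ 1) k = 0 := by
  ext r s
  simp [matV, Matrix.circulant_apply, pad, Sigma.ext_iff, h]

end Linear

section Probe

/-- The parameter with the same `U^l` and the same `V^k`, `k ≠ l`, as `θ`, with `U^{l+1}` and
`V^l` given by the filters `α` and `β`, and with all other `U^k` equal to zero. -/
noncomputable def probe (A : ConvArch q p) (l : ℕ) (θ : A.Param)
    (α : ∀ k, Fin A.c × Fin (A.width k) × Fin (A.nu k) → ℝ)
    (β : ∀ k, Fin (A.width k) × Fin A.c × Fin (A.nv k) → ℝ) : A.Param :=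
  WithLp.toLp 2 fun idx => match idx with
    | ⟨k, Sum.inl t⟩ => if (k : ℕ) = l then θ ⟨k, Sum.inl t⟩ else
        if (k : ℕ) = l + 1 then α k t else 0
    | ⟨k, Sum.inr t⟩ => if (k : ℕ) = l then β k t else θ ⟨k, Sum.inr t⟩

variable (A : ConvArch q p) {l : ℕ} (θ : A.Param)
  (α : ∀ k, Fin A.c × Fin (A.width k) × Fin (A.nu k) → ℝ)
  (β : ∀ k, Fin (A.width k) × Fin A.c × Fin (A.nv k) → ℝ)

theorem overlap_probe (hl : l + 1 < q) :
    A.overlap ⟨l, Nat.lt_of_succ_lt hl⟩ ⟨l + 1, hl⟩ (A.probe l θ α β) =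
      A.overlap ⟨l, Nat.lt_of_succ_lt hl⟩ ⟨l + 1, hl⟩ θ := by
  simp [overlap, probe]

theorem matU_probe {k : Fin q} (h1 : (k : ℕ) ≠ l) (h2 : (k : ℕ) ≠ l + 1) :
    A.matU (A.probe l θ α β) k = 0 := by
  ext r s
  simp [matU, probe, h1, h2, pad, Matrix.circulant_apply]

theorem matV_probe {k : Fin q} (h1 : (k : ℕ) ≠ l) :
    A.matV (A.probe l θ α β) k = A.matV θ k := by
  ext r s
  simp [matV, probe, h1]

theorem continuous_probe_smul : Continuous fun δ : ℝ => A.probe l θ (δ • α) (δ • β) := by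
  refine (PiLp.continuous_toLp 2 _).comp (continuous_pi ?_)
  rintro ⟨k, t | t⟩
  · dsimp only
    split_ifs
    · exact continuous_const
    · exact continuous_id.mul continuous_const
    · exact continuous_const
  · dsimp only
    split_ifs
    · exact continuous_id.mul continuous_const
    · exact continuous_const

theorem matU_probe_zero {k : Fin q} (h : (k : ℕ) ≠ l) : A.matU (A.probe l θ 0 β) k = 0 := by
  ext r s
  simp [matU, probe, h, pad, Matrix.circulant_apply]

theorem matV_probe_zero {k : Fin q} (h : (k : ℕ) = l) : A.matV (A.probe l θ α 0) k = 0 := by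
  ext r s
  simp [matV, probe, h, pad, Matrix.circulant_apply]

theorem matV_probe_smul {k : Fin q} (h : (k : ℕ) = l) (δ : ℝ) :
    A.matV (A.probe l θ α (δ • β)) k = δ • A.matV (A.probe l θ α β) k := by
  ext r s
  simp only [matV, probe, h, pad, Matrix.circulant_apply, Matrix.of_apply, Matrix.smul_apply]
  split_ifs <;> simp

variable [NeZero p]

theorem continuous_block (k : Fin q) {z : A.Param → A.Feat} (hz : Continuous z) :
    Continuous fun θ => A.block θ k (z θ) := by
  have h1 : Continuous fun θ : A.Param => A.matU θ k :=
    continuous_matrix fun r s => A.continuous_matU k r s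
  have h2 : Continuous fun θ : A.Param => A.matV θ k :=
    continuous_matrix fun r s => A.continuous_matV k r s
  refine hz.add (h1.matrix_mulVec (continuous_pi fun r => ?_))
  exact ((continuous_apply r).comp (h2.matrix_mulVec hz)).max continuous_const

theorem continuous_partialNet (x : A.Feat) (n : ℕ) :
    Continuous fun θ : A.Param => A.partialNet θ x n := by
  induction n with
  | zero => exact continuous_const
  | succ n ih =>
    simp only [partialNet]
    split_ifs with hn
    · exact A.continuous_block ⟨n, hn⟩ ih
    · exact ih

theorem partialNet_eq_self {A : ConvArch q p} {θ : A.Param} {n : ℕ}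
    (h : ∀ k : Fin q, (k : ℕ) < n → A.matU θ k = 0 ∨ A.matV θ k = 0) (x : A.Feat) :
    A.partialNet θ x n = x := by
  induction n with
  | zero => rfl
  | succ n ih =>
    rw [partialNet, ih fun k hk => h k (by omega)]
    split_ifs with hn
    · rcases h ⟨n, hn⟩ (by simp) with h' | h'
      · exact A.block_eq_self h' x
      · simp only [block, h', Matrix.zero_mulVec, Pi.zero_apply, max_self]
        exact add_eq_left.2 (Matrix.mulVec_zero _)
    · rfl

/-- If the filters of `V^l` and `U^{l+1}` are replaced by small multiples of given ones, all blocks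
are close to the identity: the parameter is interior to the admissible set, and the network is
smooth at any input that avoids the hyperplanes of the neurons. -/
theorem eventually_probe_smul (hl : l + 1 < q) {θ : A.Param}
    (hrow : ∀ k r, (A.matV θ k).row r ≠ 0)
    (hpair : Pairwise fun r r' => LinearIndependent ℝ
      ![(A.matV θ ⟨l + 1, hl⟩).row r, (A.matV θ ⟨l + 1, hl⟩).row r']) {x : A.Feat}
    (hx : ∀ k r, (A.matV θ k).mulVec x r ≠ 0)
    (hβ : ∀ r, (A.matV (A.probe l θ 0 β) ⟨l, Nat.lt_of_succ_lt hl⟩).mulVec x r ≠ 0) :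
    ∀ᶠ δ in 𝓝[>] (0 : ℝ), 0 < δ ∧
      A.admissible ⟨l + 1, hl⟩ ∈ 𝓝 (A.probe l θ (δ • α) (δ • β)) ∧
      ∀ k r, (A.matV (A.probe l θ (δ • α) (δ • β)) k).mulVec
        (A.partialNet (A.probe l θ (δ • α) (δ • β)) x k) r ≠ 0 := by
  have hc := A.continuous_probe_smul (l := l) θ α β
  have hUV : ∀ k : Fin q, A.matU (A.probe l θ ((0 : ℝ) • α) ((0 : ℝ) • β)) k = 0 ∨
      A.matV (A.probe l θ ((0 : ℝ) • α) ((0 : ℝ) • β)) k = 0 := fun k => by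
    rw [zero_smul, zero_smul]
    rcases eq_or_ne (k : ℕ) l with hk | hk
    · exact Or.inr (A.matV_probe_zero θ 0 hk)
    · exact Or.inl (A.matU_probe_zero θ 0 hk)
  have h1 : ∀ᶠ δ : ℝ in 𝓝 0, ∀ k, A.residualBound (A.probe l θ (δ • α) (δ • β)) k < 1 := by
    refine eventually_all.2 fun k => ?_
    refine ((A.continuous_residualBound k).comp hc).continuousAt.eventually (gt_mem_nhds ?_)
    change A.residualBound (A.probe l θ ((0 : ℝ) • α) ((0 : ℝ) • β)) k < 1
    rcases hUV k with h | h <;> simp only [residualBound, h] <;> simp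
  have h2 : ∀ᶠ δ : ℝ in 𝓝 0, ∀ (k : Fin q) r, (k : ℕ) ≠ l →
      (A.matV (A.probe l θ (δ • α) (δ • β)) k).mulVec
        (A.partialNet (A.probe l θ (δ • α) (δ • β)) x k) r ≠ 0 := by
    refine eventually_all.2 fun k => eventually_all.2 fun r => ?_
    by_cases hk : (k : ℕ) = l
    · simp [hk]
    · have hV : Continuous fun θ : A.Param => A.matV θ k :=
        continuous_matrix fun r s => A.continuous_matV k r s
      have hcont : Continuous fun θ : A.Param =>
          (A.matV θ k).mulVec (A.partialNet θ x k) r :=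
        (continuous_apply r).comp (hV.matrix_mulVec (A.continuous_partialNet x k))
      refine ((hcont.comp hc).continuousAt.eventually_ne ?_).mono fun _ h _ => h
      simp only [Function.comp_apply]
      rw [partialNet_eq_self fun k _ => hUV k, A.matV_probe θ _ _ hk]
      exact hx k r
  filter_upwards [nhdsWithin_le_nhds h1, nhdsWithin_le_nhds h2, self_mem_nhdsWithin]
    with δ h1 h2 hδ
  have hδ0 : δ ≠ 0 := ne_of_gt hδ
  have hVl : ∀ r, (A.matV (A.probe l θ (δ • α) (δ • β)) ⟨l, Nat.lt_of_succ_lt hl⟩).mulVec x r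
      ≠ 0 := fun r => by
    rw [A.matV_probe_smul (l := l) θ _ β (k := ⟨l, Nat.lt_of_succ_lt hl⟩) rfl,
      Matrix.smul_mulVec, Pi.smul_apply, smul_eq_mul]
    refine mul_ne_zero hδ0 ?_
    have : A.matV (A.probe l θ (δ • α) β) ⟨l, Nat.lt_of_succ_lt hl⟩ =
        A.matV (A.probe l θ 0 β) ⟨l, Nat.lt_of_succ_lt hl⟩ := rfl
    rw [this]
    exact hβ r
  refine ⟨hδ, A.admissible_mem_nhds h1 (fun k r => ?_) ?_, fun k r => ?_⟩
  · by_cases hk : (k : ℕ) = l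
    · obtain rfl : k = ⟨l, Nat.lt_of_succ_lt hl⟩ := Fin.ext hk
      intro h0
      apply hVl r
      rw [Matrix.mulVec]
      exact (congrArg (· ⬝ᵥ x) h0).trans (zero_dotProduct x)
    · rw [A.matV_probe θ _ _ hk]
      exact hrow k r
  · rw [A.matV_probe θ _ _ (by simp)]
    exact hpair
  · by_cases hk : (k : ℕ) = l
    · obtain rfl : k = ⟨l, Nat.lt_of_succ_lt hl⟩ := Fin.ext hk
      rw [partialNet_eq_self]
      · exact hVl r
      · intro k hk
        exact Or.inl (A.matU_probe θ _ _ (by simp at hk; omega) (by simp at hk; omega))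
    · exact h2 k r hk

end Probe

end ConvArch

/-! ### Neutral directions of the overlap -/

namespace ConvArch

variable {q p : ℕ}

theorem pad_natCast {n : ℕ} (hn : n ≤ p) (f : Fin n → ℝ) (t : Fin n) :
    pad p f ((t : ℕ) : ZMod p) = f t := by
  have h : ((t : ℕ) : ZMod p).val = t := ZMod.val_natCast_of_lt (t.2.trans_le hn)
  simp [pad, h]

variable [NeZero p]

section LineDerivatives

variable (A : ConvArch q p) {l : ℕ} (hl : l + 1 < q) {θ e : A.Param} {x : A.Feat}

theorem hasDerivAt_net_matU (hU : ∀ k : Fin q, (k : ℕ) ≠ l → A.matU θ k = 0)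
    (he : ∀ k : Fin q, (k : ℕ) ≠ l → A.matU e k = 0)
    (heV : A.matV e ⟨l, Nat.lt_of_succ_lt hl⟩ = 0) (r : Fin A.c × ZMod p) :
    HasDerivAt (fun τ : ℝ => A.net (θ + τ • e) x r)
      ((A.matU e ⟨l, Nat.lt_of_succ_lt hl⟩).mulVec
        (fun s => max ((A.matV θ ⟨l, Nat.lt_of_succ_lt hl⟩).mulVec x s) 0) r) 0 := by
  have hz : ∀ (τ : ℝ) (k : Fin q), (k : ℕ) ≠ l → A.matU (θ + τ • e) k = 0 := fun τ k hk => by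
    rw [matU_add_smul, hU k hk, he k hk, smul_zero, add_zero]
  have heq : (fun τ : ℝ => A.net (θ + τ • e) x r) = fun τ : ℝ =>
      (x r + (A.matU θ ⟨l, Nat.lt_of_succ_lt hl⟩).mulVec
        (fun s => max ((A.matV θ ⟨l, Nat.lt_of_succ_lt hl⟩).mulVec x s) 0) r) +
      τ * (A.matU e ⟨l, Nat.lt_of_succ_lt hl⟩).mulVec
        (fun s => max ((A.matV θ ⟨l, Nat.lt_of_succ_lt hl⟩).mulVec x s) 0) r := by
    funext τ
    rw [A.net_eq_block_block hl (fun k hk _ => hz τ k hk), A.block_eq_self (hz τ _ (by simp)),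
      block, matU_add_smul, matV_add_smul, heV, smul_zero, add_zero, Matrix.add_mulVec,
      Matrix.smul_mulVec]
    simp [add_assoc]
  rw [heq]
  exact (hasDerivAt_mul_const _).const_add _

theorem hasDerivAt_net_matV
    (hU : ∀ k : Fin q, (k : ℕ) ≠ l → (k : ℕ) ≠ l + 1 → A.matU θ k = 0)
    (hx : ∀ s, (A.matV θ ⟨l, Nat.lt_of_succ_lt hl⟩).mulVec x s ≤ 0)
    (he : ∀ k : Fin q, A.matU e k = 0)
    (heV : A.matV e ⟨l, Nat.lt_of_succ_lt hl⟩ = 0) {r : Fin A.c × ZMod p}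
    {s₀ : Fin (A.width ⟨l + 1, hl⟩) × ZMod p}
    (hr : ∀ s, s ≠ s₀ → A.matU θ ⟨l + 1, hl⟩ r s = 0)
    (hs₀ : 0 < (A.matV θ ⟨l + 1, hl⟩).mulVec x s₀) :
    HasDerivAt (fun τ : ℝ => A.net (θ + τ • e) x r)
      (A.matU θ ⟨l + 1, hl⟩ r s₀ * (A.matV e ⟨l + 1, hl⟩).mulVec x s₀) 0 := by
  have hz : ∀ (τ : ℝ) (k : Fin q), A.matU (θ + τ • e) k = A.matU θ k := fun τ k => by
    rw [matU_add_smul, he k, smul_zero, add_zero]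
  have heq : (fun τ : ℝ => A.net (θ + τ • e) x r) = fun τ : ℝ =>
      x r + A.matU θ ⟨l + 1, hl⟩ r s₀ * max ((A.matV θ ⟨l + 1, hl⟩).mulVec x s₀ +
        τ * (A.matV e ⟨l + 1, hl⟩).mulVec x s₀) 0 := by
    funext τ
    have hbl : A.block (θ + τ • e) ⟨l, Nat.lt_of_succ_lt hl⟩ x = x := by
      rw [block, matV_add_smul, heV, smul_zero, add_zero]
      simp only [max_eq_right (hx _)]
      exact add_eq_left.2 (Matrix.mulVec_zero _)
    rw [A.net_eq_block_block hl (fun k h1 h2 => (hz τ k).trans (hU k h1 h2)), hbl, block, hz,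
      matV_add_smul, Matrix.add_mulVec, Matrix.smul_mulVec, Pi.add_apply, Matrix.mulVec,
      dotProduct, Finset.sum_eq_single s₀]
    · rfl
    · intro s _ hs
      rw [hr s hs, zero_mul]
    · simp
  have hlin : HasDerivAt (fun τ : ℝ => (A.matV θ ⟨l + 1, hl⟩).mulVec x s₀ +
      τ * (A.matV e ⟨l + 1, hl⟩).mulVec x s₀) ((A.matV e ⟨l + 1, hl⟩).mulVec x s₀) 0 := by
    exact (hasDerivAt_mul_const _).const_add _
  have hmax : HasDerivAt (fun τ : ℝ => max ((A.matV θ ⟨l + 1, hl⟩).mulVec x s₀ +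
      τ * (A.matV e ⟨l + 1, hl⟩).mulVec x s₀) 0) ((A.matV e ⟨l + 1, hl⟩).mulVec x s₀) 0 := by
    refine hlin.congr_of_eventuallyEq ?_
    filter_upwards [hlin.continuousAt.eventually (lt_mem_nhds (by simpa using hs₀))] with τ hτ
    exact max_eq_left (le_of_lt hτ)
  rw [heq]
  exact (hmax.const_mul _).const_add _

end LineDerivatives

section Directions

/-- The rows of all the matrices `V^k`. -/
def rowSet (A : ConvArch q p) (θ : A.Param) : Set A.Feat :=
  range fun kr : Σ k, Fin (A.width k) × ZMod p => (A.matV θ kr.1).row kr.2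

theorem finite_rowSet (A : ConvArch q p) (θ : A.Param) : (A.rowSet θ).Finite :=
  finite_range _

/-- All entries of the filters `u^l` can be moved individually. A single neuron of block `l` is
made active, and `U^{l+1} = 0` freezes the other filters that are read. -/
theorem exists_isNeutralDirection_single (A : ConvArch q p) {l : ℕ} (hl : l + 1 < q)
    (hnu : ∀ k, A.nu k ≤ p) (hnv : ∀ k, A.nv k = p)
    {h : A.Overlap ⟨l, Nat.lt_of_succ_lt hl⟩ ⟨l + 1, hl⟩ → ℝ}
    (hcons : IsConservationLaw A.net euclideanLoss (A.admissible ⟨l + 1, hl⟩)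
      (fun θ => h (A.overlap ⟨l, Nat.lt_of_succ_lt hl⟩ ⟨l + 1, hl⟩ θ)))
    {θ : A.Param} (hθ : θ ∈ A.admissible ⟨l + 1, hl⟩)
    (t : Fin A.c × Fin (A.width ⟨l, Nat.lt_of_succ_lt hl⟩) ×
      Fin (A.nu ⟨l, Nat.lt_of_succ_lt hl⟩)) :
    ∃ y : ℝ, y ≠ 0 ∧ IsNeutralDirection h
      (A.overlap ⟨l, Nat.lt_of_succ_lt hl⟩ ⟨l + 1, hl⟩ θ) (0, Pi.single t y) := by
  obtain ⟨i₀, j₀, t₀⟩ := t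
  -- An input close to a multiple of the unit impulse in channel `i₀`.
  obtain ⟨x, hxo, hxr⟩ : ∃ x : A.Feat, ∑ s ∈ Finset.univ.erase (i₀, 0), |x s| < x (i₀, 0) ∧
      ∀ v ∈ A.rowSet θ, v ⬝ᵥ x ≠ 0 := by
    have hopen : IsOpen {x : A.Feat | ∑ s ∈ Finset.univ.erase (i₀, 0), |x s| < x (i₀, 0)} :=
      isOpen_lt (by fun_prop) (by fun_prop)
    have hmem : ∑ s ∈ Finset.univ.erase (i₀, (0 : ZMod p)),
        |(Pi.single (i₀, 0) 1 : A.Feat) s| < (Pi.single (i₀, 0) 1 : A.Feat) (i₀, 0) := by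
      rw [Finset.sum_eq_zero fun s hs => by simp [Finset.ne_of_mem_erase hs], Pi.single_eq_same]
      exact one_pos
    refine (dense_setOf_dotProduct_ne_zero (A.finite_rowSet θ) ?_).inter_open_nonempty _ hopen
      ⟨_, hmem⟩
    rintro _ ⟨⟨k, r⟩, rfl⟩
    exact hθ.2.1 k r
  -- The sign pattern of the filters of `V^l`: only the neuron `(j₀, 0)` responds positively.
  let β : ∀ k, Fin (A.width k) × Fin A.c × Fin (A.nv k) → ℝ := fun k t =>
    if t.2.1 = i₀ then (if (t.1 : ℕ) = j₀ ∧ (t.2.2 : ℕ) = 0 then 1 else -1) else 0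
  have hentry : ∀ r s, A.matV (A.probe l θ 0 β) ⟨l, Nat.lt_of_succ_lt hl⟩ r s =
      if s.1 = i₀ then (if r.1 = j₀ ∧ r.2 = s.2 then 1 else -1) else 0 := fun r s => by
    have hlt : (r.2 - s.2).val < A.nv ⟨l, Nat.lt_of_succ_lt hl⟩ :=
      (hnv ⟨l, Nat.lt_of_succ_lt hl⟩).symm ▸ ZMod.val_lt _
    simp [matV, probe, pad, Matrix.circulant_apply, hlt, β, Fin.ext_iff, sub_eq_zero]
  have hdom : ∀ r, |(A.matV (A.probe l θ 0 β) ⟨l, Nat.lt_of_succ_lt hl⟩).mulVec x r -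
      A.matV (A.probe l θ 0 β) ⟨l, Nat.lt_of_succ_lt hl⟩ r (i₀, 0) * x (i₀, 0)| <
        x (i₀, 0) := fun r => by
    rw [Matrix.mulVec, dotProduct, ← Finset.add_sum_erase _ _ (Finset.mem_univ (i₀, 0)),
      add_sub_cancel_left]
    refine (Finset.abs_sum_le_sum_abs _ _).trans_lt
      ((Finset.sum_le_sum fun s _ => ?_).trans_lt hxo)
    rw [abs_mul]
    refine mul_le_of_le_one_left (abs_nonneg _) ?_
    rw [hentry]
    split_ifs <;> simp
  have hpos : 0 < (A.matV (A.probe l θ 0 β) ⟨l, Nat.lt_of_succ_lt hl⟩).mulVec x (j₀, 0) := by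
    have h1 := hdom (j₀, 0)
    rw [hentry] at h1
    simp only [and_self, if_true, one_mul] at h1
    linarith [(abs_lt.1 h1).1]
  have hneg : ∀ r, r ≠ (j₀, 0) →
      (A.matV (A.probe l θ 0 β) ⟨l, Nat.lt_of_succ_lt hl⟩).mulVec x r < 0 := fun r hr => by
    have h1 := hdom r
    rw [hentry] at h1
    rw [if_pos rfl, if_neg (fun h => hr (Prod.ext h.1 h.2))] at h1
    linarith [(abs_lt.1 h1).2]
  obtain ⟨δ, hδ, hΘ, hsm⟩ := (A.eventually_probe_smul 0 β hl hθ.2.1 hθ.2.2 (x := x)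
    (fun k r => hxr _ ⟨⟨k, r⟩, rfl⟩) (fun r => by
      rcases eq_or_ne r (j₀, 0) with rfl | hr
      exacts [hpos.ne', (hneg r hr).ne])).exists
  rw [smul_zero] at hΘ hsm
  have hact :
      (fun s => max ((A.matV (A.probe l θ 0 (δ • β)) ⟨l, Nat.lt_of_succ_lt hl⟩).mulVec x s) 0) =
      Pi.single (j₀, 0)
        (δ * (A.matV (A.probe l θ 0 β) ⟨l, Nat.lt_of_succ_lt hl⟩).mulVec x (j₀, 0)) := by
    funext s
    rw [A.matV_probe_smul (l := l) θ 0 β (k := ⟨l, Nat.lt_of_succ_lt hl⟩) rfl,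
      Matrix.smul_mulVec, Pi.smul_apply, smul_eq_mul]
    rcases eq_or_ne s (j₀, 0) with rfl | hs
    · rw [Pi.single_eq_same, max_eq_left (mul_pos hδ hpos).le]
    · rw [Pi.single_eq_of_ne hs, max_eq_right (mul_neg_of_pos_of_neg hδ (hneg s hs)).le]
  refine ⟨δ * (A.matV (A.probe l θ 0 β) ⟨l, Nat.lt_of_succ_lt hl⟩).mulVec x (j₀, 0),
    (mul_pos hδ hpos).ne', ?_⟩
  have key := A.isNeutralDirection_fderiv_net hcons hΘ hsm (i₀, ((t₀ : ℕ) : ZMod p))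
  rw [A.overlap_probe θ 0 (δ • β) hl] at key
  convert key using 1
  refine Prod.ext (funext fun t => ?_) (funext fun t => ?_)
  · refine (A.fderiv_net_apply hsm ((A.hasDerivAt_net_matU hl
      (fun k hk => A.matU_probe_zero θ _ hk) (fun k _ => A.matU_single_inr _ _ _)
      (A.matV_single_of_ne (by simp) _) _).congr_deriv ?_)).symm
    rw [A.matU_single_inr, Matrix.zero_mulVec]
    rfl
  · refine (A.fderiv_net_apply hsm ((A.hasDerivAt_net_matU hl
      (fun k hk => A.matU_probe_zero θ _ hk)
      (fun k hk => A.matU_single_of_ne (fun h => hk (by simp [h])) _)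
      (A.matV_single_inl _ _ _) _).congr_deriv ?_)).symm
    rw [hact, Matrix.mulVec, dotProduct_single]
    simp only [matU, Matrix.of_apply, Matrix.circulant_apply, sub_zero]
    rw [pad_natCast (hnu _)]
    simp only [Pi.single_apply, PiLp.single_apply]
    by_cases ht : t = (i₀, j₀, t₀)
    · simp [ht]
    · rw [if_neg, if_neg ht, zero_mul]
      intro h
      apply ht
      simpa using h.symm

/-- The filters `v^{l+1}_j` of one hidden channel can be moved in the direction of any generic
input (with pixels reversed) that activates the neuron `(j, 0)`, up to some motion of the filters
`u^l`: the input passes block `l` unchanged since no neuron is active there. -/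
theorem exists_isNeutralDirection_of_pos (A : ConvArch q p) {l : ℕ} (hl : l + 1 < q)
    (hnu : ∀ k, 0 < A.nu k) (hnv : ∀ k, A.nv k = p)
    {h : A.Overlap ⟨l, Nat.lt_of_succ_lt hl⟩ ⟨l + 1, hl⟩ → ℝ}
    (hcons : IsConservationLaw A.net euclideanLoss (A.admissible ⟨l + 1, hl⟩)
      (fun θ => h (A.overlap ⟨l, Nat.lt_of_succ_lt hl⟩ ⟨l + 1, hl⟩ θ)))
    {θ : A.Param} (hθ : θ ∈ A.admissible ⟨l + 1, hl⟩) (i₀ : Fin A.c)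
    (j₀ : Fin (A.width ⟨l + 1, hl⟩)) {x : A.Feat} (hxr : ∀ v ∈ A.rowSet θ, v ⬝ᵥ x ≠ 0)
    (hxs : ∑ s, x s ≠ 0) (hxp : 0 < (A.matV θ ⟨l + 1, hl⟩).row (j₀, 0) ⬝ᵥ x) :
    ∃ (y : ℝ) (u : _), y ≠ 0 ∧ IsNeutralDirection h
      (A.overlap ⟨l, Nat.lt_of_succ_lt hl⟩ ⟨l + 1, hl⟩ θ)
      (y • fun t => if t.1 = j₀ then x (t.2.1, -((t.2.2 : ℕ) : ZMod p)) else 0, u) := by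
  -- Constant filters in `V^l`, with the sign that makes all neurons of block `l` inactive.
  let β : ∀ k, Fin (A.width k) × Fin A.c × Fin (A.nv k) → ℝ := fun k t => -∑ s, x s
  -- `U^{l+1}` only connects the neuron `(j₀, 0)` to the pixel `0` of channel `i₀`.
  let α : ∀ k, Fin A.c × Fin (A.width k) × Fin (A.nu k) → ℝ := fun k t =>
    if t.1 = i₀ ∧ (t.2.1 : ℕ) = j₀ ∧ (t.2.2 : ℕ) = 0 then 1 else 0
  have hneg : ∀ (α' : ∀ k, Fin A.c × Fin (A.width k) × Fin (A.nu k) → ℝ) (r),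
      (A.matV (A.probe l θ α' β) ⟨l, Nat.lt_of_succ_lt hl⟩).mulVec x r < 0 := fun α' r => by
    have : (A.matV (A.probe l θ α' β) ⟨l, Nat.lt_of_succ_lt hl⟩).mulVec x r =
        -((∑ s, x s) * ∑ s, x s) := by
      rw [Matrix.mulVec, dotProduct, ← neg_mul, Finset.mul_sum]
      refine Finset.sum_congr rfl fun s _ => ?_
      have hlt : (r.2 - s.2).val < A.nv ⟨l, Nat.lt_of_succ_lt hl⟩ :=
        (hnv ⟨l, Nat.lt_of_succ_lt hl⟩).symm ▸ ZMod.val_lt _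
      simp [matV, probe, pad, Matrix.circulant_apply, hlt, β]
    rw [this]
    exact neg_neg_of_pos (mul_self_pos.2 hxs)
  obtain ⟨δ, hδ, hΘ, hsm⟩ := (A.eventually_probe_smul α β hl hθ.2.1 hθ.2.2 (x := x)
    (fun k r => hxr _ ⟨⟨k, r⟩, rfl⟩) (fun r => (hneg 0 r).ne)).exists
  have hU : ∀ s, A.matU (A.probe l θ (δ • α) (δ • β)) ⟨l + 1, hl⟩ (i₀, 0) s =
      if s = (j₀, 0) then δ else 0 := fun s => by
    rcases eq_or_ne s (j₀, 0) with rfl | hs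
    · simp [matU, probe, pad, Matrix.circulant_apply, α, hnu]
    · simp [matU, probe, pad, Matrix.circulant_apply, α, hs]
      exact fun _ h1 h2 => absurd (Prod.ext (Fin.ext h1) h2) hs
  refine ⟨δ, fun t => fderiv ℝ (fun θ => A.net θ x (i₀, 0)) (A.probe l θ (δ • α) (δ • β))
    (EuclideanSpace.single ⟨⟨l, Nat.lt_of_succ_lt hl⟩, Sum.inl t⟩ 1), hδ.ne', ?_⟩
  have key := A.isNeutralDirection_fderiv_net hcons hΘ hsm (i₀, 0)
  rw [A.overlap_probe θ (δ • α) (δ • β) hl] at key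
  convert key using 2
  funext t
  refine (A.fderiv_net_apply hsm ((A.hasDerivAt_net_matV hl
    (fun k h1 h2 => A.matU_probe θ _ _ h1 h2) (fun s => ?_) (fun k => A.matU_single_inr _ _ _)
    (A.matV_single_of_ne (by simp) _) (s₀ := (j₀, 0)) (fun s hs => ?_) ?_).congr_deriv ?_)).symm
  · rw [A.matV_probe_smul (l := l) θ _ β (k := ⟨l, Nat.lt_of_succ_lt hl⟩) rfl,
      Matrix.smul_mulVec, Pi.smul_apply, smul_eq_mul]
    exact (mul_neg_of_pos_of_neg hδ (hneg _ s)).le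
  · rw [hU, if_neg hs]
  · rw [A.matV_probe θ _ _ (by simp)]
    exact hxp
  · rw [hU, if_pos rfl, Pi.smul_apply, smul_eq_mul]
    congr 1
    obtain ⟨j, i, s⟩ := t
    have hs : (s : ℕ) < p := s.2.trans_eq (hnv _)
    rw [Matrix.mulVec, dotProduct, Finset.sum_eq_single (i, -((s : ℕ) : ZMod p))]
    · simp only [matV, Matrix.of_apply, Matrix.circulant_apply, zero_sub, neg_neg]
      rw [pad_natCast (hnv _).le]
      by_cases hj : j = j₀
      · simp [hj]
      · simp [hj, Ne.symm hj]
    · rintro ⟨i', b⟩ _ hb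
      have hlt : (0 - b).val < A.nv ⟨l + 1, hl⟩ := (hnv ⟨l + 1, hl⟩).symm ▸ ZMod.val_lt _
      simp only [matV, Matrix.of_apply, Matrix.circulant_apply, pad, dif_pos hlt]
      rw [PiLp.single_apply, if_neg, zero_mul]
      intro h
      apply hb
      simp only [Sigma.mk.injEq, heq_eq_eq, true_and, Sum.inr.injEq, Prod.mk.injEq] at h
      obtain ⟨_, rfl, hs'⟩ := h
      refine Prod.ext rfl ?_
      rw [← hs']
      simp
    · simp

end Directions

end ConvArch

/-! ### Local constancy -/

namespace ConvArch

variable {q p : ℕ} [NeZero p]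

/-- At the overlap of an admissible parameter, the neutral directions span. -/
theorem span_isNeutralDirection_eq_top (A : ConvArch q p) {l : ℕ} (hl : l + 1 < q)
    (hnu : ∀ k, 0 < A.nu k ∧ A.nu k ≤ p) (hnv : ∀ k, A.nv k = p)
    {h : A.Overlap ⟨l, Nat.lt_of_succ_lt hl⟩ ⟨l + 1, hl⟩ → ℝ}
    (hcons : IsConservationLaw A.net euclideanLoss (A.admissible ⟨l + 1, hl⟩)
      (fun θ => h (A.overlap ⟨l, Nat.lt_of_succ_lt hl⟩ ⟨l + 1, hl⟩ θ)))
    {θ : A.Param} (hθ : θ ∈ A.admissible ⟨l + 1, hl⟩) :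
    Submodule.span ℝ {w | IsNeutralDirection h
      (A.overlap ⟨l, Nat.lt_of_succ_lt hl⟩ ⟨l + 1, hl⟩ θ) w} = ⊤ := by
  rcases isEmpty_or_nonempty (Fin A.c) with hc | ⟨⟨i₀⟩⟩
  · exact Subsingleton.elim _ _
  set S := Submodule.span ℝ {w | IsNeutralDirection h
      (A.overlap ⟨l, Nat.lt_of_succ_lt hl⟩ ⟨l + 1, hl⟩ θ) w}
  have hu : ∀ u, ((0, u) : A.Overlap ⟨l, Nat.lt_of_succ_lt hl⟩ ⟨l + 1, hl⟩) ∈ S := fun u => by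
    have hsum : ((0, u) : A.Overlap ⟨l, Nat.lt_of_succ_lt hl⟩ ⟨l + 1, hl⟩) =
        ∑ t, (0, Pi.single t (u t)) := by
      refine Prod.ext ?_ ?_
      · simp [Prod.fst_sum]
      · rw [Prod.snd_sum]
        exact (Finset.univ_sum_single u).symm
    rw [hsum]
    refine S.sum_mem fun t _ => ?_
    obtain ⟨y, hy, hd⟩ := A.exists_isNeutralDirection_single hl (fun k => (hnu k).2) hnv hcons hθ t
    have := S.smul_mem (u t / y) (Submodule.subset_span hd)
    rwa [Prod.smul_mk, smul_zero, ← Pi.single_smul', smul_eq_mul, div_mul_cancel₀ _ hy] at this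
  -- The filters of the channel `j` that are read off an input.
  let T : Fin (A.width ⟨l + 1, hl⟩) → A.Feat →ₗ[ℝ]
      A.Overlap ⟨l, Nat.lt_of_succ_lt hl⟩ ⟨l + 1, hl⟩ :=
    fun j =>
    { toFun := fun x => (fun t => if t.1 = j then x (t.2.1, -((t.2.2 : ℕ) : ZMod p)) else 0, 0)
      map_add' := fun x x' => by
        refine Prod.ext (funext fun t => ?_) (by simp)
        by_cases ht : t.1 = j <;> simp [ht]
      map_smul' := fun a x => by
        refine Prod.ext (funext fun t => ?_) (by simp)
        by_cases ht : t.1 = j <;> simp [ht] }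
  have hT : ∀ j x, T j x ∈ S := fun j x => by
    have hfin := (A.finite_rowSet θ).insert (1 : A.Feat)
    have hrow0 : ∀ v ∈ insert (1 : A.Feat) (A.rowSet θ), v ≠ 0 := by
      rintro _ (rfl | ⟨⟨k, r⟩, rfl⟩)
      · exact fun h0 => one_ne_zero (congrFun h0 (i₀, 0))
      · exact hθ.2.1 k r
    have hopen : IsOpen {x : A.Feat | 0 < (A.matV θ ⟨l + 1, hl⟩).row (j, 0) ⬝ᵥ x} :=
      isOpen_lt continuous_const (continuous_const.dotProduct continuous_id)
    have hne : 0 < (A.matV θ ⟨l + 1, hl⟩).row (j, 0) ⬝ᵥ (A.matV θ ⟨l + 1, hl⟩).row (j, 0) :=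
      lt_of_le_of_ne (Finset.sum_nonneg fun i _ => mul_self_nonneg _)
        (fun h0 => hθ.2.1 _ (j, 0) (dotProduct_self_eq_zero.1 h0.symm))
    have hint : (interior ((S.comap (T j) : Submodule ℝ A.Feat) : Set A.Feat)).Nonempty := by
      obtain ⟨x₀, hx₀⟩ := (dense_setOf_dotProduct_ne_zero hfin hrow0).inter_open_nonempty _ hopen
        ⟨_, hne⟩
      refine ⟨x₀, mem_interior.2 ⟨_, ?_,
        hopen.inter (isOpen_setOf_dotProduct_ne_zero hfin), hx₀⟩⟩
      rintro x ⟨hxp, hxr⟩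
      obtain ⟨y, u, hy, hd⟩ := A.exists_isNeutralDirection_of_pos hl (fun k => (hnu k).1) hnv hcons
        hθ i₀ j (fun v hv => hxr v (mem_insert_of_mem _ hv))
        (by simpa [dotProduct] using hxr 1 (mem_insert _ _)) hxp
      have h1 := S.smul_mem y⁻¹ (S.sub_mem (Submodule.subset_span hd) (hu u))
      rw [Prod.mk_sub_mk, sub_zero, sub_self, Prod.smul_mk, smul_smul, inv_mul_cancel₀ hy,
        one_smul, smul_zero] at h1
      exact h1
    have htop := (S.comap (T j)).eq_top_of_nonempty_interior' hint
    have hx : x ∈ S.comap (T j) := by rw [htop]; trivial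
    exact hx
  rw [eq_top_iff]
  rintro ⟨v, u⟩ -
  have hv : ((v, 0) : A.Overlap ⟨l, Nat.lt_of_succ_lt hl⟩ ⟨l + 1, hl⟩) =
      ∑ j, T j fun s => v (j, s.1, ⟨(-s.2).val, (hnv _).symm ▸ ZMod.val_lt _⟩) := by
    refine Prod.ext (funext fun t => ?_) ?_
    · obtain ⟨j, i, s⟩ := t
      have hs : (s : ℕ) < p := s.2.trans_eq (hnv _)
      simp [T, Prod.fst_sum, Finset.sum_apply, Nat.mod_eq_of_lt hs]
    · simp [T, Prod.snd_sum]
  have : (v, u) = (v, 0) + ((0, u) : A.Overlap ⟨l, Nat.lt_of_succ_lt hl⟩ ⟨l + 1, hl⟩) := by simp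
  rw [this, hv]
  exact S.add_mem (S.sum_mem fun j _ => hT j _) (hu u)

/-- A conserved function of `(V^{l+1}, U^l)` is locally constant. -/
theorem eventually_eq_of_isConservationLaw (A : ConvArch q p) {l : ℕ} (hl : l + 1 < q)
    (hnu : ∀ k, 0 < A.nu k ∧ A.nu k ≤ p) (hnv : ∀ k, A.nv k = p)
    {h : A.Overlap ⟨l, Nat.lt_of_succ_lt hl⟩ ⟨l + 1, hl⟩ → ℝ}
    (hcons : IsConservationLaw A.net euclideanLoss (A.admissible ⟨l + 1, hl⟩)
      (fun θ => h (A.overlap ⟨l, Nat.lt_of_succ_lt hl⟩ ⟨l + 1, hl⟩ θ)))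
    {a : A.Overlap ⟨l, Nat.lt_of_succ_lt hl⟩ ⟨l + 1, hl⟩}
    (ha : a ∈ A.overlap ⟨l, Nat.lt_of_succ_lt hl⟩ ⟨l + 1, hl⟩ '' A.admissible ⟨l + 1, hl⟩) :
    ∀ᶠ b in 𝓝 a, h b = h a := by
  obtain ⟨θ, hθ, rfl⟩ := ha
  exact eventually_eq_of_span_isNeutralDirection
    (A.span_isNeutralDirection_eq_top hl hnu hnv hcons hθ)

end ConvArch

/-- A function that is locally constant at every point of a set takes one value on each
preconnected subset. -/
theorem IsPreconnected.eq_of_eventually_eq {X Y : Type*} [TopologicalSpace X] {s : Set X}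
    (hs : IsPreconnected s) {f : X → Y} (hf : ∀ a ∈ s, ∀ᶠ b in 𝓝 a, f b = f a) {x y : X}
    (hx : x ∈ s) (hy : y ∈ s) : f x = f y := by
  let _ : TopologicalSpace Y := ⊥
  have : DiscreteTopology Y := ⟨rfl⟩
  refine hs.constant_of_mapsTo (T := univ) ?_ (fun a ha => ?_) (mapsTo_univ _ _) hx hy
  · rw [isDiscrete_iff_discreteTopology]; infer_instance
  · refine ContinuousAt.continuousWithinAt ?_
    rw [ContinuousAt, nhds_discrete Y, tendsto_pure]
    exact hf a ha

/-! ### Generic families of vectors -/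

theorem finrank_span_singleton_le_one {Y : Type*} [AddCommGroup Y] [Module ℝ Y] (y : Y) :
    Module.finrank ℝ (Submodule.span ℝ {y}) ≤ 1 := by
  simpa using finrank_span_le_card (R := ℝ) ({y} : Set Y)

/-- Given two points, each outside a finite collection of subspaces of codimension at least two,
a common third point can be joined to both by segments avoiding the respective subspaces. -/
theorem exists_segment_forall_notMem {X : Type*} [AddCommGroup X] [Module ℝ X]
    [FiniteDimensional ℝ X] {B₀ B₁ : Set (Submodule ℝ X)} (hB₀ : B₀.Finite) (hB₁ : B₁.Finite)
    (hr₀ : ∀ E ∈ B₀, Module.finrank ℝ E + 2 ≤ Module.finrank ℝ X)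
    (hr₁ : ∀ E ∈ B₁, Module.finrank ℝ E + 2 ≤ Module.finrank ℝ X) {x₀ x₁ : X}
    (hx₀ : ∀ E ∈ B₀, x₀ ∉ E) (hx₁ : ∀ E ∈ B₁, x₁ ∉ E) :
    ∃ w, (∀ y ∈ segment ℝ x₀ w, ∀ E ∈ B₀, y ∉ E) ∧ ∀ y ∈ segment ℝ x₁ w, ∀ E ∈ B₁, y ∉ E := by
  classical
  have hproper : ∀ (E : Submodule ℝ X) (x : X),
      Module.finrank ℝ E + 2 ≤ Module.finrank ℝ X → E ⊔ Submodule.span ℝ {x} ≠ ⊤ :=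
    fun E x hE h => by
      have h1 := Submodule.finrank_add_le_finrank_add_finrank E (Submodule.span ℝ {x})
      have h2 := finrank_span_singleton_le_one x
      rw [h, finrank_top] at h1
      omega
  have hfin : ((fun E => E ⊔ Submodule.span ℝ {x₀}) '' B₀ ∪
      (fun E => E ⊔ Submodule.span ℝ {x₁}) '' B₁).Finite := (hB₀.image _).union (hB₁.image _)
  have hne := Subspace.biUnion_ne_univ_of_top_notMem (s := hfin.toFinset) (by
    rw [Set.Finite.mem_toFinset]
    rintro (⟨E, hE, h⟩ | ⟨E, hE, h⟩)
    · exact hproper E x₀ (hr₀ E hE) h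
    · exact hproper E x₁ (hr₁ E hE) h)
  obtain ⟨w, hw⟩ := (ne_univ_iff_exists_notMem _).1 hne
  simp only [mem_iUnion, Set.Finite.mem_toFinset, not_exists, SetLike.mem_coe] at hw
  -- If the segment from `x` to `w` met `E`, then either `x ∈ E` or `w` would lie in `E + ℝ x`.
  have key : ∀ (E : Submodule ℝ X) (x : X), x ∉ E → w ∉ E ⊔ Submodule.span ℝ {x} →
      ∀ y ∈ segment ℝ x w, y ∉ E := by
    rintro E x hx hwE y ⟨a, b, -, -, hab, rfl⟩ hy
    rcases eq_or_ne b 0 with rfl | hb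
    · simp only [add_zero] at hab
      exact hx (by simpa [hab] using hy)
    · apply hwE
      have : w = b⁻¹ • (a • x + b • w) + (-(b⁻¹ * a)) • x := by
        rw [smul_add, smul_smul, smul_smul, inv_mul_cancel₀ hb]
        module
      rw [this]
      exact Submodule.add_mem_sup (E.smul_mem _ hy)
        (Submodule.smul_mem _ _ (Submodule.mem_span_singleton_self x))
  exact ⟨w, fun y hy E hE => key E x₀ (hx₀ E hE) (hw _ (Or.inl ⟨E, hE, rfl⟩)) y hy,
    fun y hy E hE => key E x₁ (hx₁ E hE) (hw _ (Or.inr ⟨E, hE, rfl⟩)) y hy⟩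

section Generic

variable {J G X Y : Type*} [NormedAddCommGroup X] [NormedSpace ℝ X]
  [NormedAddCommGroup Y] [NormedSpace ℝ Y]

theorem LinearIsometry.apply_ne_zero (T : X →ₗᵢ[ℝ] Y) {x : X} (hx : x ≠ 0) : T x ≠ 0 :=
  norm_ne_zero_iff.1 (by rwa [T.norm_map, norm_ne_zero_iff])

/-- A family of vectors is *generic* for a collection `T` of isometries if the vectors are nonzero
and all their images are pairwise non-colinear. -/
def IsGenericFamily (T : G → X →ₗᵢ[ℝ] Y) (v : J → X) : Prop :=
  (∀ j, v j ≠ 0) ∧ Pairwise fun r r' : J × G =>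
    LinearIndependent ℝ ![T r.2 (v r.1), T r'.2 (v r'.1)]

/-- The subspaces that the `j`-th member of a generic family has to avoid, the other members being
fixed. -/
def badSubspaces (T : G → X →ₗᵢ[ℝ] Y) (v : J → X) (j : J) : Set (Submodule ℝ X) :=
  {⊥} ∪ range (fun s : {ab : G × G // ab.1 ≠ ab.2} × ℤˣ =>
      LinearMap.ker ((T s.1.1.1).toLinearMap - (s.2 : ℝ) • (T s.1.1.2).toLinearMap)) ∪
    range (fun s : G × G × {j' : J // j' ≠ j} =>
      (Submodule.span ℝ {T s.2.1 (v s.2.2)}).comap (T s.1).toLinearMap)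

theorem finite_badSubspaces [Finite J] [Finite G] (T : G → X →ₗᵢ[ℝ] Y) (v : J → X) (j : J) :
    (badSubspaces T v j).Finite :=
  ((finite_singleton _).union (finite_range _)).union (finite_range _)

theorem finrank_badSubspaces [FiniteDimensional ℝ X] {T : G → X →ₗᵢ[ℝ] Y}
    (hX : 3 ≤ Module.finrank ℝ X)
    (hT : ∀ a b, a ≠ b → ∀ σ : ℝ,
      Module.finrank ℝ (LinearMap.ker ((T a).toLinearMap - σ • (T b).toLinearMap)) + 2 ≤
        Module.finrank ℝ X) (v : J → X) (j : J) :
    ∀ E ∈ badSubspaces T v j, Module.finrank ℝ E + 2 ≤ Module.finrank ℝ X := by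
  rintro _ ((rfl | ⟨⟨⟨⟨a, b⟩, hab⟩, σ⟩, rfl⟩) | ⟨⟨a, b, j'⟩, rfl⟩)
  · rw [finrank_bot]; omega
  · exact hT a b hab σ
  · have h1 := (Submodule.equivMapOfInjective (T a).toLinearMap (T a).injective
      ((Submodule.span ℝ {T b (v j')}).comap (T a).toLinearMap)).finrank_eq
    have h2 := Submodule.finrank_mono
      (Submodule.map_comap_le (T a).toLinearMap (Submodule.span ℝ {T b (v j')}))
    have h3 := finrank_span_singleton_le_one (T b (v j'))
    simp only at h1 h2 h3 ⊢
    omega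

theorem IsGenericFamily.notMem_of_mem_badSubspaces {T : G → X →ₗᵢ[ℝ] Y} {v : J → X}
    (hv : IsGenericFamily T v) (j : J) : ∀ E ∈ badSubspaces T v j, v j ∉ E := by
  rintro _ ((rfl | ⟨⟨⟨⟨a, b⟩, hab⟩, σ⟩, rfl⟩) | ⟨⟨a, b, j', hj'⟩, rfl⟩) hmem
  · exact hv.1 j (by simpa using hmem)
  · have hli : LinearIndependent ℝ ![T b (v j), T a (v j)] :=
      hv.2 (i := (j, b)) (j := (j, a)) fun h => hab (congrArg Prod.snd h).symm
    rw [LinearIndependent.pair_iff' (LinearIsometry.apply_ne_zero (T b) (hv.1 j))] at hli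
    have h0 : T a (v j) - (σ : ℝ) • T b (v j) = 0 := LinearMap.mem_ker.1 hmem
    exact hli (σ : ℝ) (sub_eq_zero.1 h0).symm
  · have hli : LinearIndependent ℝ ![T b (v j'), T a (v j)] :=
      hv.2 (i := (j', b)) (j := (j, a)) fun h => hj' (congrArg Prod.fst h)
    rw [LinearIndependent.pair_iff' (LinearIsometry.apply_ne_zero (T b) (hv.1 j'))] at hli
    obtain ⟨σ, hσ⟩ := Submodule.mem_span_singleton.1 hmem
    exact hli σ hσ

theorem IsGenericFamily.update [DecidableEq J] {T : G → X →ₗᵢ[ℝ] Y} {v : J → X}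
    (hv : IsGenericFamily T v) {j : J} {x : X} (hx : ∀ E ∈ badSubspaces T v j, x ∉ E) :
    IsGenericFamily T (Function.update v j x) := by
  have hx0 : x ≠ 0 := fun h => hx ⊥ (Or.inl (Or.inl rfl)) (by simp [h])
  have hmixed : ∀ a b j', j' ≠ j → LinearIndependent ℝ ![T b (v j'), T a x] :=
    fun a b j' hj' => by
      rw [LinearIndependent.pair_iff' (LinearIsometry.apply_ne_zero (T b) (hv.1 j'))]
      exact fun σ hσ => hx _ (Or.inr ⟨(a, b, ⟨j', hj'⟩), rfl⟩)
        (Submodule.mem_span_singleton.2 ⟨σ, hσ⟩)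
  refine ⟨fun j' => ?_, ?_⟩
  · rcases eq_or_ne j' j with rfl | h
    · simpa using hx0
    · simpa [h] using hv.1 j'
  · rintro ⟨j₁, a⟩ ⟨j₂, b⟩ hne
    rcases eq_or_ne j₁ j with rfl | h₁ <;> rcases eq_or_ne j₂ j₁ with rfl | h₂
    · simp only [Function.update_self]
      rw [LinearIndependent.pair_iff' (LinearIsometry.apply_ne_zero (T a) hx0)]
      intro σ hσ
      -- Isometries allow only the factors `1` and `-1`.
      have hσ1 : |σ| = 1 := by
        have h := congrArg norm hσ
        rw [norm_smul, LinearIsometry.norm_map, LinearIsometry.norm_map, Real.norm_eq_abs] at h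
        exact mul_right_cancel₀ (norm_ne_zero_iff.2 hx0) (h.trans (one_mul _).symm)
      obtain ⟨u, hu⟩ : ∃ u : ℤˣ, ((u : ℤ) : ℝ) = σ := by
        rcases (abs_eq zero_le_one).1 hσ1 with h | h
        · exact ⟨1, by simp [h]⟩
        · exact ⟨-1, by simp [h]⟩
      have hE := hx (LinearMap.ker ((T b).toLinearMap - ((u : ℤ) : ℝ) • (T a).toLinearMap))
        (Or.inl (Or.inr ⟨(⟨(b, a), fun h => hne (Prod.ext rfl h.symm)⟩, u), rfl⟩))
      refine hE (LinearMap.mem_ker.2 ?_)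
      rw [LinearMap.sub_apply, LinearMap.smul_apply, hu]
      exact sub_eq_zero.2 hσ.symm
    · simp only [Function.update_self, Function.update_of_ne h₂]
      exact LinearIndependent.pair_symm_iff.1 (hmixed a b j₂ h₂)
    · simp only [Function.update_of_ne h₁]
      exact hv.2 (i := (_, a)) (j := (_, b)) hne
    · simp only [Function.update_of_ne h₁]
      rcases eq_or_ne j₂ j with rfl | h₃
      · simp only [Function.update_self]
        exact hmixed b a j₁ h₁
      · simp only [Function.update_of_ne h₃]
        exact hv.2 (i := (_, a)) (j := (_, b)) hne

/-- A locally constant function on generic families is constant, if the isometries are generic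
enough for all the bad subspaces to have codimension at least two. The members of a family are
exchanged one at a time. -/
theorem IsGenericFamily.eq_of_eventually_eq [Finite J] [Finite G] [FiniteDimensional ℝ X]
    {T : G → X →ₗᵢ[ℝ] Y} (hX : 3 ≤ Module.finrank ℝ X)
    (hT : ∀ a b, a ≠ b → ∀ σ : ℝ,
      Module.finrank ℝ (LinearMap.ker ((T a).toLinearMap - σ • (T b).toLinearMap)) + 2 ≤
        Module.finrank ℝ X)
    {Z : Type*} {f : (J → X) → Z}
    (hf : ∀ v, IsGenericFamily T v → ∀ᶠ v' in 𝓝 v, f v' = f v) {v₀ v₁ : J → X}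
    (h₀ : IsGenericFamily T v₀) (h₁ : IsGenericFamily T v₁) : f v₀ = f v₁ := by
  classical
  have := Fintype.ofFinite J
  have hseg : ∀ (v : J → X) (j : J) (w : X), IsGenericFamily T v →
      (∀ y ∈ segment ℝ (v j) w, ∀ E ∈ badSubspaces T v j, y ∉ E) →
      f v = f (Function.update v j w) := fun v j w hv hw => by
    have hupd : Continuous fun y : X => Function.update v j y :=
      Continuous.update (f := fun _ : X => v) continuous_const j continuous_id
    have hcon : IsPreconnected ((fun y => Function.update v j y) '' segment ℝ (v j) w) :=
      (convex_segment _ _).isPreconnected.image _ hupd.continuousOn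
    refine hcon.eq_of_eventually_eq (f := f) ?_ ⟨v j, left_mem_segment _ _ _, by simp⟩
      ⟨w, right_mem_segment _ _ _, rfl⟩
    rintro _ ⟨y, hy, rfl⟩
    exact hf _ (hv.update (hw y hy))
  have key : ∀ (S : Finset J) (v₀ v₁ : J → X), IsGenericFamily T v₀ → IsGenericFamily T v₁ →
      (∀ j ∉ S, v₀ j = v₁ j) → f v₀ = f v₁ := by
    intro S
    induction S using Finset.induction_on with
    | empty => exact fun v₀ v₁ _ _ h => congrArg f (funext fun j => h j (by simp))
    | insert j S _ ih =>
      intro v₀ v₁ h₀ h₁ hag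
      obtain ⟨w, hw₀, hw₁⟩ := exists_segment_forall_notMem
        (finite_badSubspaces T v₀ j) (finite_badSubspaces T v₁ j)
        (finrank_badSubspaces hX hT v₀ j) (finrank_badSubspaces hX hT v₁ j)
        (h₀.notMem_of_mem_badSubspaces j) (h₁.notMem_of_mem_badSubspaces j)
      rw [hseg v₀ j w h₀ hw₀, hseg v₁ j w h₁ hw₁]
      refine ih _ _ (h₀.update (hw₀ w (right_mem_segment _ _ _)))
        (h₁.update (hw₁ w (right_mem_segment _ _ _))) fun j' hj' => ?_
      rcases eq_or_ne j' j with rfl | hne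
      · simp
      · simp only [Function.update_of_ne hne]
        exact hag j' (by simp [hne, hj'])
  exact key Finset.univ v₀ v₁ h₀ h₁ (by simp)

end Generic

/-! ### Circulant rows and connectedness -/

namespace ConvArch

variable {q p : ℕ} [NeZero p]

/-- The row with index `a` of the circulant blocks built from the filters `x` of one hidden
channel; reindexing the entries does not change the sup norm. -/
noncomputable def circulantRow {c n : ℕ} (hn : n = p) (a : ZMod p) :
    (Fin c × Fin n → ℝ) →ₗᵢ[ℝ] (Fin c × ZMod p → ℝ) where
  toFun x s := pad p (fun t => x (s.1, t)) (a - s.2)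
  map_add' x y := by
    funext s
    simp only [pad, Pi.add_apply]
    split_ifs <;> simp
  map_smul' r x := by
    funext s
    simp only [pad, Pi.smul_apply, RingHom.id_apply]
    split_ifs <;> simp
  norm_map' x := by
    refine le_antisymm ((pi_norm_le_iff_of_nonneg (norm_nonneg x)).2 fun s => ?_)
      ((pi_norm_le_iff_of_nonneg (norm_nonneg _)).2 fun t => ?_)
    · have hlt : (a - s.2).val < n := (ZMod.val_lt _).trans_eq hn.symm
      simpa [pad, hlt] using norm_le_pi_norm x (s.1, ⟨(a - s.2).val, hlt⟩)
    · refine le_trans (le_of_eq ?_)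
        (norm_le_pi_norm (fun s : Fin c × ZMod p => pad p (fun t => x (s.1, t)) (a - s.2))
          (t.1, a - ((t.2 : ℕ) : ZMod p)))
      rw [sub_sub_cancel, pad_natCast hn.le]

theorem circulantRow_apply {c n : ℕ} (hn : n = p) (a : ZMod p) (x : Fin c × Fin n → ℝ)
    (s : Fin c × ZMod p) : circulantRow hn a x s = pad p (fun t => x (s.1, t)) (a - s.2) := rfl

/-- The condition that a row of circulant blocks is a multiple of a shift of itself has
codimension at least two as soon as a row has at least three entries. -/
theorem finrank_ker_circulantRow_sub_smul {c n : ℕ} (hn : n = p) (hc : 3 ≤ c * p) {a b : ZMod p}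
    (hab : a ≠ b) (σ : ℝ) :
    Module.finrank ℝ (LinearMap.ker ((circulantRow (c := c) hn a).toLinearMap -
      σ • (circulantRow (c := c) hn b).toLinearMap)) + 2 ≤
        Module.finrank ℝ (Fin c × Fin n → ℝ) := by
  set D := (circulantRow (c := c) hn a).toLinearMap -
    σ • (circulantRow (c := c) hn b).toLinearMap
  -- The filter whose row with index `a` is a basis vector.
  have hbasis : ∀ s : Fin c × ZMod p, ∃ x, D x =
      Pi.single s 1 - σ • Pi.single (s.1, s.2 + (b - a)) 1 := fun s => by
    have hlt : ∀ z : ZMod p, z.val < n := fun z => (ZMod.val_lt z).trans_eq hn.symm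
    refine ⟨Pi.single (s.1, ⟨(a - s.2).val, hlt _⟩) 1, ?_⟩
    have hrow : ∀ z : ZMod p, circulantRow (c := c) hn z
        (Pi.single (s.1, ⟨(a - s.2).val, hlt _⟩) 1) = Pi.single (s.1, s.2 + (z - a)) 1 :=
      fun z => by
        funext r
        simp only [circulantRow_apply, pad, dif_pos (hlt _), Pi.single_apply, Prod.ext_iff,
          Fin.ext_iff]
        refine if_congr (and_congr_right fun _ => ?_) rfl rfl
        rw [(ZMod.val_injective p).eq_iff]
        constructor <;> intro h
        · linear_combination -h
        · linear_combination -h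
    have h1 := hrow a
    rw [sub_self, add_zero] at h1
    change circulantRow hn a _ - σ • circulantRow hn b _ = _
    rw [h1, hrow b]
  have hcpos : 0 < c := Nat.pos_of_ne_zero (by rintro rfl; simp at hc)
  let s₁ : Fin c × ZMod p := (⟨0, hcpos⟩, 0)
  obtain ⟨s₂, hs₂⟩ : ∃ s₂, s₂ ∉ ({s₁, (s₁.1, s₁.2 + (b - a))} : Finset (Fin c × ZMod p)) := by
    by_contra! hall
    have h1 := Finset.card_le_card (fun s _ => hall s :
      (Finset.univ : Finset (Fin c × ZMod p)) ⊆ {s₁, (s₁.1, s₁.2 + (b - a))})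
    have h2 : ({s₁, (s₁.1, s₁.2 + (b - a))} : Finset (Fin c × ZMod p)).card ≤ 2 :=
      Finset.card_le_two
    rw [Finset.card_univ, Fintype.card_prod, Fintype.card_fin, ZMod.card] at h1
    omega
  simp only [Finset.mem_insert, Finset.mem_singleton, not_or] at hs₂
  have hshift : ∀ s : Fin c × ZMod p, s ≠ (s.1, s.2 + (b - a)) := fun s h => by
    have := congrArg Prod.snd h
    simp only [left_eq_add, sub_eq_zero] at this
    exact hab this.symm
  obtain ⟨x₁, hx₁⟩ := hbasis s₁
  obtain ⟨x₂, hx₂⟩ := hbasis s₂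
  have hli : LinearIndependent ℝ ![D x₁, D x₂] := by
    rw [LinearIndependent.pair_iff]
    intro α β h
    have e₂ := congrFun h s₂
    simp only [hx₁, hx₂, Pi.add_apply, Pi.smul_apply, Pi.sub_apply, Pi.single_apply, if_neg hs₂.1,
      if_neg hs₂.2, if_neg (hshift s₂), smul_eq_mul] at e₂
    have hβ : β = 0 := by simpa using e₂
    have e₁ := congrFun h s₁
    simp only [hx₁, hβ, Pi.add_apply, Pi.smul_apply, Pi.sub_apply, Pi.single_apply,
      if_neg (hshift s₁), smul_eq_mul] at e₁
    exact ⟨by simpa using e₁, hβ⟩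
  have hrange : 2 ≤ Module.finrank ℝ (LinearMap.range D) := by
    have hli' : LinearIndependent ℝ
        ![(⟨D x₁, x₁, rfl⟩ : LinearMap.range D), ⟨D x₂, x₂, rfl⟩] := by
      rw [LinearIndependent.pair_iff] at hli ⊢
      exact fun α β h => hli α β (congrArg Subtype.val h)
    simpa using hli'.fintype_card_le_finrank
  have := LinearMap.finrank_range_add_finrank_ker D
  omega

/-- The condition on the rows of `V^k` in terms of the filters. -/
theorem isGenericFamily_circulantRow (A : ConvArch q p) {k : Fin q} (hnv : A.nv k = p)
    {θ : A.Param} (hrow : ∀ r, (A.matV θ k).row r ≠ 0)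
    (hpair : Pairwise fun r r' => LinearIndependent ℝ ![(A.matV θ k).row r, (A.matV θ k).row r']) :
    IsGenericFamily (circulantRow (c := A.c) hnv) fun j s => θ ⟨k, Sum.inr (j, s)⟩ := by
  refine ⟨fun j h => hrow (j, 0) ?_, hpair⟩
  exact (congrArg (circulantRow hnv 0) h).trans (map_zero _)

/-- Once the conditions on the rows hold, all other parameters can be changed so that the blocks
are open maps. -/
theorem overlap_mem_image_of_rows (A : ConvArch q p) {l : ℕ} (hl : l + 1 < q) {θ : A.Param}
    (hrow : ∀ k r, (A.matV θ k).row r ≠ 0)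
    (hpair : Pairwise fun r r' => LinearIndependent ℝ
      ![(A.matV θ ⟨l + 1, hl⟩).row r, (A.matV θ ⟨l + 1, hl⟩).row r']) :
    A.overlap ⟨l, Nat.lt_of_succ_lt hl⟩ ⟨l + 1, hl⟩ θ ∈
      A.overlap ⟨l, Nat.lt_of_succ_lt hl⟩ ⟨l + 1, hl⟩ '' A.admissible ⟨l + 1, hl⟩ := by
  have hrow0 : ∀ v ∈ A.rowSet θ, v ≠ 0 := by
    rintro _ ⟨⟨k, r⟩, rfl⟩
    exact hrow k r
  obtain ⟨x, hx⟩ := (dense_setOf_dotProduct_ne_zero (A.finite_rowSet θ) hrow0).nonempty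
  have hx' : ∀ k r, (A.matV θ k).mulVec x r ≠ 0 := fun k r => hx _ ⟨⟨k, r⟩, rfl⟩
  let β : ∀ k, Fin (A.width k) × Fin A.c × Fin (A.nv k) → ℝ := fun k t => θ ⟨k, Sum.inr t⟩
  obtain ⟨δ, -, hδ, -⟩ := (A.eventually_probe_smul 0 β hl hrow hpair hx' (fun r => by
    have hV : A.matV (A.probe l θ 0 β) ⟨l, Nat.lt_of_succ_lt hl⟩ =
        A.matV θ ⟨l, Nat.lt_of_succ_lt hl⟩ := by
      ext r s
      simp [matV, probe, β]
    rw [hV]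
    exact hx' _ r)).exists
  exact ⟨_, mem_of_mem_nhds hδ, A.overlap_probe θ _ _ hl⟩

/-- Every generic family of filters, with any filters `u`, is the overlap of an admissible
parameter, if there is an admissible parameter at all. -/
theorem mem_image_overlap (A : ConvArch q p) {l : ℕ} (hl : l + 1 < q)
    (hnv : ∀ k, A.nv k = p) {θ : A.Param} (hθ : θ ∈ A.admissible ⟨l + 1, hl⟩)
    {v : Fin (A.width ⟨l + 1, hl⟩) → Fin A.c × Fin (A.nv ⟨l + 1, hl⟩) → ℝ}
    (hv : IsGenericFamily (circulantRow (c := A.c) (hnv ⟨l + 1, hl⟩)) v) (u) :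
    (fun t => v t.1 t.2, u) ∈
      A.overlap ⟨l, Nat.lt_of_succ_lt hl⟩ ⟨l + 1, hl⟩ '' A.admissible ⟨l + 1, hl⟩ := by
  set w : A.Overlap ⟨l, Nat.lt_of_succ_lt hl⟩ ⟨l + 1, hl⟩ := (fun t => v t.1 t.2, u)
  have hrows : ∀ r, (A.matV (A.withOverlap _ _ w θ) ⟨l + 1, hl⟩).row r =
      circulantRow (hnv ⟨l + 1, hl⟩) r.2 (v r.1) := fun r => by
    funext s
    simp only [matV, Matrix.row, Matrix.of_apply, Matrix.circulant_apply, withOverlap_inr]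
    rfl
  rw [← A.overlap_withOverlap _ _ w θ]
  refine A.overlap_mem_image_of_rows hl (fun k r => ?_) fun r r' h => ?_
  · by_cases hk : k = ⟨l + 1, hl⟩
    · subst hk
      rw [hrows]
      exact LinearIsometry.apply_ne_zero _ (hv.1 _)
    · have hV : A.matV (A.withOverlap _ _ w θ) k = A.matV θ k := by
        ext r s
        simp only [matV, Matrix.of_apply, Matrix.circulant_apply, A.withOverlap_inr_of_ne hk]
      rw [hV]
      exact hθ.2.1 k r
  · change LinearIndependent ℝ ![(A.matV (A.withOverlap _ _ w θ) ⟨l + 1, hl⟩).row r,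
      (A.matV (A.withOverlap _ _ w θ) ⟨l + 1, hl⟩).row r']
    rw [hrows r, hrows r']
    exact hv.2 h

/-- With at least three features, a conserved function takes one value. -/
theorem eq_of_isConservationLaw (A : ConvArch q p) {l : ℕ} (hl : l + 1 < q)
    (hnu : ∀ k, 0 < A.nu k ∧ A.nu k ≤ p) (hnv : ∀ k, A.nv k = p) (hm : 3 ≤ A.c * p)
    {h : A.Overlap ⟨l, Nat.lt_of_succ_lt hl⟩ ⟨l + 1, hl⟩ → ℝ}
    (hcons : IsConservationLaw A.net euclideanLoss (A.admissible ⟨l + 1, hl⟩)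
      (fun θ => h (A.overlap ⟨l, Nat.lt_of_succ_lt hl⟩ ⟨l + 1, hl⟩ θ)))
    {θ₀ θ₁ : A.Param} (h₀ : θ₀ ∈ A.admissible ⟨l + 1, hl⟩) (h₁ : θ₁ ∈ A.admissible ⟨l + 1, hl⟩) :
    h (A.overlap ⟨l, Nat.lt_of_succ_lt hl⟩ ⟨l + 1, hl⟩ θ₀) =
      h (A.overlap ⟨l, Nat.lt_of_succ_lt hl⟩ ⟨l + 1, hl⟩ θ₁) := by
  let f (v : Fin (A.width ⟨l + 1, hl⟩) → Fin A.c × Fin (A.nv ⟨l + 1, hl⟩) → ℝ) : ℝ :=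
    h (fun t => v t.1 t.2, 0)
  have hloc : ∀ v, IsGenericFamily (circulantRow (c := A.c) (hnv ⟨l + 1, hl⟩)) v → ∀ u,
      ∀ᶠ b in 𝓝 ((fun t => v t.1 t.2, u) :
        A.Overlap ⟨l, Nat.lt_of_succ_lt hl⟩ ⟨l + 1, hl⟩), h b = h (fun t => v t.1 t.2, u) :=
    fun v hv u => A.eventually_eq_of_isConservationLaw hl hnu hnv hcons
      (A.mem_image_overlap hl hnv h₀ hv u)
  have hf : ∀ v, IsGenericFamily (circulantRow (c := A.c) (hnv ⟨l + 1, hl⟩)) v →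
      ∀ᶠ v' in 𝓝 v, f v' = f v := fun v hv => by
    have hc : Continuous fun v : Fin (A.width ⟨l + 1, hl⟩) →
        Fin A.c × Fin (A.nv ⟨l + 1, hl⟩) → ℝ =>
        ((fun t => v t.1 t.2, 0) : A.Overlap ⟨l, Nat.lt_of_succ_lt hl⟩ ⟨l + 1, hl⟩) := by
      fun_prop
    exact hc.continuousAt.eventually (hloc v hv 0)
  -- The filters `u` are unconstrained, so they do not matter.
  have hu : ∀ θ ∈ A.admissible ⟨l + 1, hl⟩,
      h (A.overlap ⟨l, Nat.lt_of_succ_lt hl⟩ ⟨l + 1, hl⟩ θ) =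
        f fun j s => θ ⟨⟨l + 1, hl⟩, Sum.inr (j, s)⟩ := fun θ hθ => by
    have hgen := A.isGenericFamily_circulantRow (hnv _) (hθ.2.1 _) hθ.2.2
    set v : Fin (A.width ⟨l + 1, hl⟩) → Fin A.c × Fin (A.nv ⟨l + 1, hl⟩) → ℝ :=
      fun j s => θ ⟨⟨l + 1, hl⟩, Sum.inr (j, s)⟩
    have hcon : IsPreconnected (range fun u =>
        ((fun t => v t.1 t.2, u) : A.Overlap ⟨l, Nat.lt_of_succ_lt hl⟩ ⟨l + 1, hl⟩)) :=
      isPreconnected_range (Continuous.prodMk continuous_const continuous_id)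
    have hconst := hcon.eq_of_eventually_eq (f := h)
      (by rintro _ ⟨u, rfl⟩; exact hloc v hgen u)
      ⟨(A.overlap ⟨l, Nat.lt_of_succ_lt hl⟩ ⟨l + 1, hl⟩ θ).2, rfl⟩ ⟨0, rfl⟩
    exact hconst
  rw [hu θ₀ h₀, hu θ₁ h₁]
  refine IsGenericFamily.eq_of_eventually_eq ?_
    (fun a b hab σ => finrank_ker_circulantRow_sub_smul (hnv _) hm hab σ) hf
    (A.isGenericFamily_circulantRow (hnv _) (h₀.2.1 _) h₀.2.2)
    (A.isGenericFamily_circulantRow (hnv _) (h₁.2.1 _) h₁.2.2)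
  simpa [hnv] using hm

end ConvArch

theorem mainTheorem4 {q p : ℕ} [NeZero p] (A : ConvArch q p)
    (hnu : ∀ k, 0 < A.nu k ∧ A.nu k ≤ p) (hnv : ∀ k, A.nv k = p)
    (l : ℕ) (hl : l + 1 < q)
    (h : A.Overlap ⟨l, Nat.lt_of_succ_lt hl⟩ ⟨l + 1, hl⟩ → ℝ)
    (hcons : IsConservationLaw A.net euclideanLoss (A.admissible ⟨l + 1, hl⟩)
      (fun θ => h (A.overlap ⟨l, Nat.lt_of_succ_lt hl⟩ ⟨l + 1, hl⟩ θ))) :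
    (∀ a ∈ A.overlap ⟨l, Nat.lt_of_succ_lt hl⟩ ⟨l + 1, hl⟩ '' A.admissible ⟨l + 1, hl⟩,
      ∀ b ∈ connectedComponentIn
        (A.overlap ⟨l, Nat.lt_of_succ_lt hl⟩ ⟨l + 1, hl⟩ '' A.admissible ⟨l + 1, hl⟩) a,
        h b = h a) ∧
    (3 ≤ A.c * p → ∃ C : ℝ, ∀ θ ∈ A.admissible ⟨l + 1, hl⟩,
      h (A.overlap ⟨l, Nat.lt_of_succ_lt hl⟩ ⟨l + 1, hl⟩ θ) = C) := by
  refine ⟨fun a ha b hb => ?_, fun hm => ?_⟩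
  · exact isPreconnected_connectedComponentIn.eq_of_eventually_eq
      (fun a' ha' => A.eventually_eq_of_isConservationLaw hl hnu hnv hcons
        (connectedComponentIn_subset _ _ ha')) hb (mem_connectedComponentIn ha)
  · rcases (A.admissible ⟨l + 1, hl⟩).eq_empty_or_nonempty with hemp | ⟨θ₀, hθ₀⟩
    · exact ⟨0, by simp [hemp]⟩
    · exact ⟨_, fun θ hθ => A.eq_of_isConservationLaw hl hnu hnv hm hcons hθ hθ₀⟩
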